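/- **Conventions.** Alphabets, state sets and variable sets are finite; for an alphabet $A$ let $\bar A=A\uplus\{\vdash,\dashv\}$. A 2DFT $T$ over $A$ with output alphabet $B$ has states $Q$, an initial state $q_0$, final states $F\subseteq Q$ and a (partial) transition function $\delta:Q\times\bar A\rightharpoonup B^*\times Q\times\{-1,0,+1\}$ that never moves left on $\vdash$ nor right on $\dashv$. It reads $\vdash u\dashv$, starting on $\vdash$ in state $q_0$, and stops, accepting, as soon as it is on $\dashv$ in a final state; the transduction of $T$ maps $u$ to the output produced. For $x,y\in\{\ell,r\}$, $\mathrm{bh}_{xy}(u)$ is the set of pairs $(p,q)$ such that a run over $u\in A^*$ that enters $u$ from the side $x$ in state $p$ exits $u$ on the side $y$ in state $q$ ($\mathrm{bh}_{xy}(\epsilon)$ is the identity if $x\ne y$, and empty otherwise). The transition monoid of $T$ is the quotient of $A^*$ that identifies words with the same four behaviors. A monoid $M$ is aperiodic if for some $n$ all $x\in M$ satisfy $x^n=x^{n+1}$, and $T$ is aperiodic if its transition monoid is. A (deterministic) SST has states $P$, variables $\mathcal X$, a transition function on $P\times A$, for each transition an update $\mathcal X\to(B\cup\mathcal X)^*$,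 and a partial output function $P\rightharpoonup(B\cup\mathcal X)^*$ (its domain being the final states); variables are initially empty. A run with updates $\sigma_1,\dots,\sigma_k$ induces $\sigma_1\circ\dots\circ\sigma_k$. The SST is copyless if in each update every variable occurs in at most one image, and at most once there. Its transition monoid is the set of matrices of words $u\in A^*$, whose entry at $(p,X),(q,Y)$ is $\bot$ if no run over $u$ leads from $p$ to $q$, and otherwise the number of occurrences of $X$ in the image of $Y$ under the substitution induced by this run. The SST is aperiodic if this monoid is. **Normalization.** $T^\circ$ has states $Q\uplus\{\hat p:p\in Q\}\uplus\{\iota\}$, initial state $\iota$ and final states $F$, and *starts on* $\dashv$. In state $\iota$ it moves left without output until $\vdash$, where it enters $q_0$ without moving. On symbols other than $\vdash$, a state $p\in Q$ behaves as in $T$. If $\delta(p,\vdash)=(v,q,m)$, then $T^\circ$ in state $p$ on $\vdash$ moves right into $\hat p$ without output, and in state $\hat p$ on any symbol other than $\vdash$ outputs $v$, enters $q$ and stays if $m=+1$, and moves left if $m=0$. There are no other transitions. **Construction.** Let $T$ be a 2DFT with $n$ states that starts on $\dashv$. A *merge forest* is a set $V$ of nonempty subsets of $Q$ with a map $\phi:V\to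 Q$; the father of a vertex is the least vertex that strictly contains it (vertices without father are roots). For a merge forest $G=(V,\phi)$ and $a\in\bar A$, let $G''_a$ be the graph on $V\uplus Q^{in}\uplus Q^{out}$ (two copies of $Q$) with edges from each non-root vertex to its father, from each root $s$ to $\phi(s)^{in}$, and, for $\delta(p,a)=(v,q,m)$, from $p^{in}$ to $q^{out}$ if $m=+1$, to $q^{in}$ if $m=0$, and to the least vertex containing $q$ (if there is one) if $m=-1$; for $a=\dashv$ and $p\in F$ the edge is instead $p^{in}\to p^{out}$, with output $\epsilon$. Let $\mathsf{in}(s)$ be the set of $q$ such that there is a path from $q^{in}$ to $s$. The forest $G\cdot a$ has as vertices the nonempty sets $\mathsf{in}(s)$ such that some $q^{out}$ is reachable from $s$, and maps $\mathsf{in}(s)$ to this $q$. Let $G_{\vdash w}$ be obtained from the empty forest by reading $\vdash w$. The states of the SST are the forests $G_{\vdash w}$, $w\in A^*$; the initial state is $G_{\vdash}$; reading $a$ leads from $G$ to $G\cdot a$. There are $2n-1$ variables. Choose for each state $G$ an injective labeling $\lambda_G$ of its vertices by variables. Label the nodes of $G''_a$: a vertex $s$ of $G$ by $\lambda_G(s)$,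 $p^{in}$ by the output of $T$ in state $p$ on $a$, $q^{out}$ by $\epsilon$. For a vertex $t$ of $G\cdot a$ let $\mu_{G,a}(t)$ be the concatenation of the labels of the nodes $s$ with $\mathsf{in}(s)=t$, in the order in which they follow each other on a path. The update for $a$ in state $G$ maps $\lambda_{G\cdot a}(t)$ to $\mu_{G,a}(t)$, and all other variables to $\epsilon$. The state $G$ is final if the least vertex $s$ of $G\cdot{\dashv}$ containing the initial state of $T$ exists and is mapped to a final state; its output is then the concatenation of the words $\mu_{G,\dashv}(t)$ for $t$ on the path from $s$ to its root. Call the result $S_\lambda(T)$. **Theorem.** Let $T$ be an aperiodic 2DFT. 1. Labelings $\lambda$ as required by the construction of $S_\lambda(T^\circ)$ exist, and for every one of them $S_\lambda(T^\circ)$ is a copyless SST that has the same transduction as $T$ and is aperiodic. 2. If moreover $T$ produces no output on $\vdash$, then labelings $\lambda$ as required by the construction of $S_\lambda(T)$ exist, and for every one of them $S_\lambda(T)$ is a copyless SST with $2n-1$ variables, where $n$ is the number of states of $T$, that has the same transduction as $T$ under the convention that $T$ starts on $\dashv$ instead of $\vdash$, and is aperiodic. -/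

import Mathlib

namespace TwoWay

/-! ## Words and deterministic two-way transducers -/

/-- Head moves `-1`, `0`, `+1`. -/
inductive Move
  | left
  | stay
  | right

/-- `m.Moves i j`: the move `m` leads from position `i` to position `j`. -/
def Move.Moves : Move → ℕ → ℕ → Prop
  | .left, i, j => i = j + 1
  | .stay, i, j => j = i
  | .right, i, j => j = i + 1

/-- The alphabet `A` enriched with the endmarkers `⊢` (`lend`) and `⊣` (`rend`). -/
inductive EndMarked (A : Type*)
  | lend
  | letter (a : A)
  | rend

/-- A deterministic two-way finite state transducer (2DFT) with input alphabet `A`, output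
alphabet `B` and finite set of states `Q`.  The transition function may be partial. -/
structure Transducer (A B Q : Type*) where
  init : Q
  final : Set Q
  δ : Q → EndMarked A → Option (List B × Q × Move)
  finite_states : Finite Q
  lend_ne_left : ∀ p v q, δ p .lend ≠ some (v, q, .left)
  rend_ne_right : ∀ p v q, δ p .rend ≠ some (v, q, .right)

/-- The cells of the tape `⊢ u ⊣`, at positions `0, …, |u| + 1`. -/
def tape {A : Type*} (u : List A) (i : ℕ) : Option (EndMarked A) :=
  (EndMarked.lend :: (u.map EndMarked.letter ++ [EndMarked.rend]))[i]?

/-- The cells of the bare word `u`, at positions `1, …, |u|`. -/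
def wordCell {A : Type*} (u : List A) : ℕ → Option (EndMarked A)
  | 0 => none
  | i + 1 => (u.map EndMarked.letter)[i]?

namespace Transducer

variable {A B Q : Type*}

/-- One step, with output `v`, between the configurations (state, position) `c` and `c'`. -/
def Step (T : Transducer A B Q) (cell : ℕ → Option (EndMarked A))
    (c : Q × ℕ) (v : List B) (c' : Q × ℕ) : Prop :=
  ∃ a m, cell c.2 = some a ∧ T.δ c.1 a = some (v, c'.1, m) ∧ m.Moves c.2 c'.2

/-- The accepting configurations on the input `u`. -/
def Accepting (T : Transducer A B Q) (u : List A) (c : Q × ℕ) : Prop :=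
  c.2 = u.length + 1 ∧ c.1 ∈ T.final

/-- `T.AccRun u c v`: the run on `⊢ u ⊣` that starts in `c` reaches an accepting configuration, and
`v` is its output up to the first one. -/
inductive AccRun (T : Transducer A B Q) (u : List A) : Q × ℕ → List B → Prop
  | done (c : Q × ℕ) (h : T.Accepting u c) : AccRun T u c []
  | step (c c' : Q × ℕ) (v w : List B) (h : ¬ T.Accepting u c)
      (hs : T.Step (tape u) c v c') (hr : AccRun T u c' w) : AccRun T u c (v ++ w)

/-- The transduction of `T`: the head starts on `⊢`. -/
def Realizes (T : Transducer A B Q) (u : List A) (v : List B) : Prop :=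
  T.AccRun u (T.init, 0) v

/-- The transduction of `T` under the convention that the head starts on `⊣`. -/
def RealizesFromRight (T : Transducer A B Q) (u : List A) (v : List B) : Prop :=
  T.AccRun u (T.init, u.length + 1) v

end Transducer

/-! ## The transition monoid of a two-way transducer -/

/-- A monoid is aperiodic if there is `n` with `x ^ n = x ^ (n + 1)` for all its elements `x`. -/
def IsAperiodicMonoid (M : Type*) [Monoid M] : Prop :=
  ∃ n : ℕ, ∀ x : M, x ^ n = x ^ (n + 1)

/-- The two ends of a word. -/
inductive Side
  | left
  | right

/-- Position of the first cell read when a word of length `n` is entered from a side. -/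
def Side.entry : Side → ℕ → ℕ
  | .left, _ => 1
  | .right, n => n

/-- Position reached when a word of length `n` is exited on a side. -/
def Side.exit : Side → ℕ → ℕ
  | .left, _ => 0
  | .right, n => n + 1

/-- Position, in a concatenation `u v` with `|u| = n`, of the first cell read when moving from the
common boundary of `u` and `v` towards a side. -/
def Side.mid : Side → ℕ → ℕ
  | .left, n => n
  | .right, n => n + 1

namespace Transducer

variable {A B Q : Type*}

/-- A step inside the bare word `u`, outputs being forgotten. -/
def WordStep (T : Transducer A B Q) (u : List A) (c c' : Q × ℕ) : Prop :=
  ∃ v, T.Step (wordCell u) c v c'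

/-- The behavior `bh_xy(u)`: pairs `(p, q)` such that some run over `u` enters `u` in state `p` from
the side `x` and exits it in state `q` on the side `y`.  For the empty word this is the identity if
`x ≠ y` and is empty otherwise. -/
def beh (T : Transducer A B Q) (x y : Side) (u : List A) : Set (Q × Q) :=
  {pq | Relation.ReflTransGen (T.WordStep u)
    (pq.1, x.entry u.length) (pq.2, y.exit u.length)}

/-- Runs over a concatenation from the middle to an exit, described by the behaviors
of the two factors. -/
inductive Mid (bu bv : Side → Side → Set (Q × Q)) : Side → Q → Side → Q → Prop
  | exitL (p q : Q) (h : (p, q) ∈ bu .right .left) : Mid bu bv .left p .left q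
  | bounceL (p p' : Q) (y : Side) (q : Q) (h : (p, p') ∈ bu .right .right)
      (hm : Mid bu bv .right p' y q) : Mid bu bv .left p y q
  | exitR (p q : Q) (h : (p, q) ∈ bv .left .right) : Mid bu bv .right p .right q
  | bounceR (p p' : Q) (y : Side) (q : Q) (h : (p, p') ∈ bv .left .left)
      (hm : Mid bu bv .left p' y q) : Mid bu bv .right p y q

theorem wordCell_pos {u : List A} {i : ℕ} {a : EndMarked A} (h : wordCell u i = some a) :
    1 ≤ i ∧ i ≤ u.length := by
  cases i with
  | zero => simp [wordCell] at h
  | succ i =>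
    have := (List.getElem?_eq_some_iff.1 h).1
    simp at this
    omega

theorem wordCell_append_left {u : List A} (v : List A) {i : ℕ} (h : i ≤ u.length) :
    wordCell (u ++ v) i = wordCell u i := by
  cases i with
  | zero => rfl
  | succ i =>
    simp only [wordCell, List.map_append]
    exact List.getElem?_append_left (by simpa using h)

theorem wordCell_append_right (u v : List A) {i : ℕ} (h : 1 ≤ i) :
    wordCell (u ++ v) (u.length + i) = wordCell v i := by
  obtain ⟨i, rfl⟩ : ∃ j, i = j + 1 := ⟨i - 1, by omega⟩
  rw [← Nat.add_assoc]
  simp only [wordCell, List.map_append]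
  rw [List.getElem?_append_right (by simp)]
  simp

theorem Move.Moves_shift {m : Move} {i j : ℕ} (k : ℕ) :
    m.Moves (k + i) (k + j) ↔ m.Moves i j := by
  cases m <;> simp only [Move.Moves] <;> omega

theorem run_left (T : Transducer A B Q) {u : List A} (v : List A) {c c' : Q × ℕ}
    (h : Relation.ReflTransGen (T.WordStep u) c c') :
    Relation.ReflTransGen (T.WordStep (u ++ v)) c c' := by
  refine Relation.ReflTransGen.mono ?_ _ _ h
  rintro a b ⟨w, x, m, h1, h2, h3⟩
  exact ⟨w, x, m, by rw [wordCell_append_left v (wordCell_pos h1).2]; exact h1, h2, h3⟩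

theorem run_right (T : Transducer A B Q) (u : List A) {v : List A} {c c' : Q × ℕ}
    (h : Relation.ReflTransGen (T.WordStep v) c c') :
    Relation.ReflTransGen (T.WordStep (u ++ v)) (c.1, u.length + c.2) (c'.1, u.length + c'.2) := by
  refine Relation.ReflTransGen.lift (fun c : Q × ℕ => (c.1, u.length + c.2)) ?_ _ _ h
  rintro a b ⟨w, x, m, h1, h2, h3⟩
  exact ⟨w, x, m, by
    rw [wordCell_append_right u v (wordCell_pos h1).1]; exact h1, h2, (Move.Moves_shift _).2 h3⟩

theorem run_of_mid (T : Transducer A B Q) (u v : List A) {x y : Side} {p q : Q}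
    (h : Mid (fun a b => T.beh a b u) (fun a b => T.beh a b v) x p y q) :
    Relation.ReflTransGen (T.WordStep (u ++ v)) (p, x.mid u.length)
      (q, y.exit (u ++ v).length) := by
  induction h with
  | exitL p q h => exact T.run_left v h
  | bounceL p p' y q h _ ih => exact Relation.ReflTransGen.trans (T.run_left v h) ih
  | exitR p q h =>
    have := T.run_right u (h : Relation.ReflTransGen _ _ _)
    simpa [Side.exit, Side.entry, Side.mid, Nat.add_assoc] using this
  | bounceR p p' y q h _ ih => exact Relation.ReflTransGen.trans (T.run_right u h) ih

theorem run_split (T : Transducer A B Q) (u v : List A) {y : Side} {q : Q} {c : Q × ℕ}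
    (h : Relation.ReflTransGen (T.WordStep (u ++ v)) c (q, y.exit (u ++ v).length)) :
    (c.2 ≤ u.length →
      (Relation.ReflTransGen (T.WordStep u) c (q, 0) ∧ y = .left) ∨
      ∃ p, Relation.ReflTransGen (T.WordStep u) c (p, u.length + 1) ∧
        Mid (fun a b => T.beh a b u) (fun a b => T.beh a b v) .right p y q) ∧
    (∀ i, 1 ≤ i → c.2 = u.length + i →
      (Relation.ReflTransGen (T.WordStep v) (c.1, i) (q, v.length + 1) ∧ y = .right) ∨
      ∃ p, Relation.ReflTransGen (T.WordStep v) (c.1, i) (p, 0) ∧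
        Mid (fun a b => T.beh a b u) (fun a b => T.beh a b v) .left p y q) := by
  induction h using Relation.ReflTransGen.head_induction_on with
  | refl =>
    cases y with
    | left => exact ⟨fun _ => Or.inl ⟨.refl, rfl⟩, fun i hi h => by simp only [Side.exit] at h; omega⟩
    | right =>
      refine ⟨fun h => by simp only [Side.exit, List.length_append] at h; omega,
        fun i hi h => Or.inl ⟨?_, rfl⟩⟩
      obtain rfl : i = v.length + 1 := by simp only [Side.exit, List.length_append] at h; omega
      exact .refl
  | @head c c' hs _ ih =>
    obtain ⟨w, x, m, h1, h2, h3⟩ := hs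
    obtain ⟨p, k⟩ := c
    obtain ⟨p', k'⟩ := c'
    have hk : k' ≤ k + 1 ∧ k ≤ k' + 1 := by
      cases m <;> simp only [Move.Moves] at h3 <;> omega
    have midR : k' = u.length + 1 →
        Mid (fun a b => T.beh a b u) (fun a b => T.beh a b v) .right p' y q := by
      intro e
      rcases ih.2 1 le_rfl e with ⟨h, rfl⟩ | ⟨r, h, hm⟩
      · exact .exitR _ _ h
      · exact .bounceR _ _ _ _ h hm
    have midL : k' = u.length →
        Mid (fun a b => T.beh a b u) (fun a b => T.beh a b v) .left p' y q := by
      rintro rfl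
      rcases ih.1 le_rfl with ⟨h, rfl⟩ | ⟨r, h, hm⟩
      · exact .exitL _ _ h
      · exact .bounceL _ _ _ _ h hm
    constructor
    · intro hc
      have st : T.WordStep u (p, k) (p', k') :=
        ⟨w, x, m, by rw [← wordCell_append_left v hc]; exact h1, h2, h3⟩
      by_cases hk' : k' ≤ u.length
      · rcases ih.1 hk' with ⟨h, e⟩ | ⟨r, h, hm⟩
        · exact Or.inl ⟨.head st h, e⟩
        · exact Or.inr ⟨r, .head st h, hm⟩
      · obtain rfl : k' = u.length + 1 := by simp only at hc; omega
        exact Or.inr ⟨p', .single st, midR rfl⟩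
    · rintro i hi rfl
      obtain ⟨j, rfl⟩ : ∃ j, k' = u.length + j := ⟨k' - u.length, by omega⟩
      have st : T.WordStep v (p, i) (p', j) :=
        ⟨w, x, m, by rw [← wordCell_append_right u v hi]; exact h1, h2,
          (Move.Moves_shift u.length).1 h3⟩
      by_cases hj : 1 ≤ j
      · rcases ih.2 j hj rfl with ⟨h, e⟩ | ⟨r, h, hm⟩
        · exact Or.inl ⟨.head st h, e⟩
        · exact Or.inr ⟨r, .head st h, hm⟩
      · obtain rfl : j = 0 := by omega
        exact Or.inr ⟨p', .single st, midL rfl⟩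

theorem beh_append_left (T : Transducer A B Q) (u v : List A) (y : Side) (p q : Q) :
    (p, q) ∈ T.beh .left y (u ++ v) ↔
      ((p, q) ∈ T.beh .left .left u ∧ y = .left) ∨ ∃ r, (p, r) ∈ T.beh .left .right u ∧
        Mid (fun a b => T.beh a b u) (fun a b => T.beh a b v) .right r y q := by
  constructor
  · intro h
    by_cases hu : 1 ≤ u.length
    · exact (T.run_split u v h).1 hu
    · obtain rfl : u = [] := List.length_eq_zero_iff.1 (by omega)
      refine Or.inr ⟨p, .refl, ?_⟩
      rcases (T.run_split [] v h).2 1 le_rfl rfl with ⟨h, rfl⟩ | ⟨r, h, hm⟩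
      · exact .exitR _ _ h
      · exact .bounceR _ _ _ _ h hm
  · rintro (⟨h, rfl⟩ | ⟨r, h, hm⟩)
    · exact T.run_left v h
    · exact Relation.ReflTransGen.trans (T.run_left v h) (T.run_of_mid u v hm)

theorem beh_append_right (T : Transducer A B Q) (u v : List A) (y : Side) (p q : Q) :
    (p, q) ∈ T.beh .right y (u ++ v) ↔
      ((p, q) ∈ T.beh .right .right v ∧ y = .right) ∨ ∃ r, (p, r) ∈ T.beh .right .left v ∧
        Mid (fun a b => T.beh a b u) (fun a b => T.beh a b v) .left r y q := by
  have e : (u ++ v).length = u.length + v.length := List.length_append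
  constructor
  · intro h
    by_cases hv : 1 ≤ v.length
    · exact (T.run_split u v h).2 v.length hv e
    · obtain rfl : v = [] := List.length_eq_zero_iff.1 (by omega)
      refine Or.inr ⟨p, .refl, ?_⟩
      rcases (T.run_split u [] h).1 (by simp [Side.entry]) with ⟨h, rfl⟩ | ⟨r, h, hm⟩
      · refine .exitL _ _ ?_
        simpa [beh, Side.entry, Side.exit] using h
      · refine .bounceL _ r _ _ ?_ hm
        simpa [beh, Side.entry, Side.exit] using h
  · rintro (⟨h, rfl⟩ | ⟨r, h, hm⟩)
    · have := T.run_right u h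
      simpa [beh, Side.entry, Side.exit, Nat.add_assoc] using this
    · refine Relation.ReflTransGen.trans ?_ (T.run_of_mid u v hm)
      have := T.run_right u h
      simpa [Side.entry, Side.exit, Side.mid] using this

/-- Two words are congruent if they have the same four behaviors. -/
def behCon (T : Transducer A B Q) : Con (FreeMonoid A) where
  r u v := ∀ x y : Side, T.beh x y u.toList = T.beh x y v.toList
  iseqv := ⟨fun _ _ _ => rfl, fun h x y => (h x y).symm, fun h h' x y => (h x y).trans (h' x y)⟩
  mul' := by
    intro u u' v v' hu hv x y
    have eu : (fun a b => T.beh a b u.toList) = fun a b => T.beh a b u'.toList := by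
      funext a b; exact hu a b
    have ev : (fun a b => T.beh a b v.toList) = fun a b => T.beh a b v'.toList := by
      funext a b; exact hv a b
    ext ⟨p, q⟩
    cases x with
    | left =>
      rw [FreeMonoid.toList_mul, FreeMonoid.toList_mul, beh_append_left, beh_append_left, eu, ev,
        hu, hu]
    | right =>
      rw [FreeMonoid.toList_mul, FreeMonoid.toList_mul, beh_append_right, beh_append_right, eu, ev,
        hv, hv]

/-- The transition monoid of a two-way transducer. -/
abbrev TransitionMonoid (T : Transducer A B Q) : Type _ := T.behCon.Quotient

/-- A two-way transducer is aperiodic if its transition monoid is. -/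
def Aperiodic (T : Transducer A B Q) : Prop := IsAperiodicMonoid T.TransitionMonoid

end Transducer
/-! ## Streaming string transducers -/

/-- Substitutions: mappings from variables to words over output letters and variables. -/
abbrev Subst (B X : Type*) := X → List (B ⊕ X)

/-- The extension of a substitution to words over `B ⊎ X`. -/
def Subst.apply {B X : Type*} (σ : Subst B X) (l : List (B ⊕ X)) : List (B ⊕ X) :=
  l.flatMap (Sum.elim (fun b => [Sum.inl b]) σ)

/-- The composition `σ τ`, mapping `Y` to the image under `σ` of the word `τ Y`. -/
def Subst.comp {B X : Type*} (σ τ : Subst B X) : Subst B X := fun Y => σ.apply (τ Y)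

/-- Replacement of all variables by the empty word. -/
def eraseVars {B X : Type*} (l : List (B ⊕ X)) : List B := l.filterMap Sum.getLeft?

open Classical in
/-- Number of occurrences of the variable `x` in a word. -/
noncomputable def occ {B X : Type*} (x : X) (l : List (B ⊕ X)) : ℕ :=
  (l.map (Sum.elim (fun _ => 0) fun y => if y = x then 1 else 0)).sum

/-- A (deterministic) streaming string transducer, with set of states `P` and set of variables `X`.
A transition carries its variable update.  The final states are those where `out` is defined. -/
structure SST (A B P X : Type*) where
  init : P
  δ : P → A → Option (P × Subst B X)
  out : P → Option (List (B ⊕ X))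
  finite_states : Finite P
  finite_vars : Finite X

namespace SST

variable {A B P X : Type*}

/-- The state reached from `p` by reading a word, with the substitution induced by the run. -/
def run (S : SST A B P X) : P → List A → Option (P × Subst B X)
  | p, [] => some (p, fun x => [Sum.inr x])
  | p, a :: u =>
    match S.δ p a with
    | none => none
    | some (q, σ) =>
      match run S q u with
      | none => none
      | some (r, τ) => some (r, σ.comp τ)

/-- The transduction of `S`; all variables are initially empty. -/
def Realizes (S : SST A B P X) (u : List A) (v : List B) : Prop :=
  ∃ p σ l, S.run S.init u = some (p, σ) ∧ S.out p = some l ∧ v = eraseVars (σ.apply l)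

/-- A substitution is copyless if every variable occurs in at most one image, and at most once
there. -/
def CopylessSubst (σ : Subst B X) : Prop :=
  (∀ x y z, Sum.inr x ∈ σ y → Sum.inr x ∈ σ z → y = z) ∧ ∀ x y, occ x (σ y) ≤ 1

/-- `S` is copyless if all its variable updates are. -/
def Copyless (S : SST A B P X) : Prop :=
  ∀ p a q σ, S.δ p a = some (q, σ) → CopylessSubst σ

open Classical in
/-- The matrix of a word `u` in the flow transition monoid: the entry at `(p, x), (q, y)` is `⊥` if
there is no run over `u` from `p` to `q`, and otherwise it is the number of occurrences of `x` in
the image of `y` under the substitution induced by this run. -/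
noncomputable def flow (S : SST A B P X) (u : List A) : Matrix (P × X) (P × X) (WithBot ℕ) :=
  fun i j =>
    match S.run i.1 u with
    | none => ⊥
    | some (q, σ) => if q = j.1 then ((occ i.2 (σ j.2) : ℕ) : WithBot ℕ) else ⊥

theorem flow_eq_coe (S : SST A B P X) (u : List A) (p q : P) (x y : X) (n : ℕ) :
    S.flow u (p, x) (q, y) = (n : WithBot ℕ) ↔
      ∃ σ, S.run p u = some (q, σ) ∧ occ x (σ y) = n := by
  unfold flow
  cases h : S.run p u with
  | none => simp
  | some c =>
    obtain ⟨r, σ⟩ := c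
    by_cases hr : r = q
    · subst hr; simp
    · simp [hr]

theorem flow_ext (S : SST A B P X) (u v : List A)
    (h : ∀ p x q y n, S.flow u (p, x) (q, y) = ((n : ℕ) : WithBot ℕ) ↔
      S.flow v (p, x) (q, y) = ((n : ℕ) : WithBot ℕ)) : S.flow u = S.flow v := by
  funext ⟨p, x⟩ ⟨q, y⟩
  have h' := h p x q y
  generalize S.flow u (p, x) (q, y) = m at *
  generalize S.flow v (p, x) (q, y) = k at *
  cases m with
  | coe m => exact ((h' m).1 rfl).symm
  | bot =>
    cases k with
    | coe k => exact (h' k).2 rfl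
    | bot => rfl

theorem comp_assoc (σ τ ρ : Subst B X) : (σ.comp τ).comp ρ = σ.comp (τ.comp ρ) := by
  funext y
  simp only [Subst.comp, Subst.apply, List.flatMap_assoc]
  congr 1
  funext z
  cases z <;> simp [Subst.comp, Subst.apply]

theorem run_append (S : SST A B P X) (u v : List A) (p : P) :
    S.run p (u ++ v) =
      match S.run p u with
      | none => none
      | some (q, σ) =>
        match S.run q v with
        | none => none
        | some (r, τ) => some (r, σ.comp τ) := by
  induction u generalizing p with
  | nil =>
    simp only [List.nil_append, run]
    cases S.run p v with
    | none => rfl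
    | some c =>
      obtain ⟨r, τ⟩ := c
      have : Subst.comp (fun x => [Sum.inr x]) τ = τ := by
        funext y
        simp only [Subst.comp, Subst.apply]
        conv_rhs => rw [← List.flatMap_singleton' (τ y)]
        congr 1
        funext z
        cases z <;> rfl
      simp [this]
  | cons a u ih =>
    simp only [List.cons_append, run]
    cases S.δ p a with
    | none => rfl
    | some c =>
      obtain ⟨q, σ⟩ := c
      simp only [ih]
      cases S.run q u with
      | none => rfl
      | some c =>
        obtain ⟨r, τ⟩ := c
        simp only
        cases S.run r v with
        | none => rfl
        | some c => simp [comp_assoc]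

theorem occ_apply [Fintype X] (σ : Subst B X) (x : X) (l : List (B ⊕ X)) :
    occ x (σ.apply l) = ∑ z, occ z l * occ x (σ z) := by
  classical
  induction l with
  | nil => simp [Subst.apply, occ]
  | cons b l ih =>
    have h1 : occ x (σ.apply (b :: l)) =
        occ x (Sum.elim (fun b => [Sum.inl b]) σ b) + occ x (σ.apply l) := by
      simp [Subst.apply, occ]
    have h2 : ∀ z, occ z (b :: l) = occ z [b] + occ z l := by
      intro z; simp [occ]
    rw [h1, ih]
    simp only [h2, add_mul, Finset.sum_add_distrib]
    congr 1
    cases b <;> simp [occ]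

/-- Two words are congruent if they have the same matrix. -/
def flowCon (S : SST A B P X) : Con (FreeMonoid A) where
  r u v := S.flow u.toList = S.flow v.toList
  iseqv := ⟨fun _ => rfl, fun h => h.symm, fun h h' => h.trans h'⟩
  mul' := by
    intro u u' v v' hu hv
    have key : ∀ u u' v v' : List A, S.flow u = S.flow u' → S.flow v = S.flow v' →
        ∀ p x q y n, S.flow (u ++ v) (p, x) (q, y) = ((n : ℕ) : WithBot ℕ) →
          S.flow (u' ++ v') (p, x) (q, y) = ((n : ℕ) : WithBot ℕ) := by
      intro u u' v v' hu hv p x q y n h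
      have := S.finite_vars
      have := Fintype.ofFinite X
      rw [flow_eq_coe] at h ⊢
      obtain ⟨ρ, hρ, rfl⟩ := h
      rw [run_append] at hρ
      cases h1 : S.run p u with
      | none => simp [h1] at hρ
      | some c =>
        obtain ⟨r, σ⟩ := c
        cases h2 : S.run r v with
        | none => simp [h1, h2] at hρ
        | some c =>
          obtain ⟨q', τ⟩ := c
          simp only [h1, h2, Option.some.injEq, Prod.mk.injEq] at hρ
          obtain ⟨rfl, rfl⟩ := hρ
          have h3 : ∀ z, ∃ σ', S.run p u' = some (r, σ') ∧ occ x (σ' z) = occ x (σ z) := by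
            intro z
            rw [← flow_eq_coe, ← hu, flow_eq_coe]
            exact ⟨σ, h1, rfl⟩
          have h4 : ∀ z, ∃ τ', S.run r v' = some (q', τ') ∧ occ z (τ' y) = occ z (τ y) := by
            intro z
            rw [← flow_eq_coe, ← hv, flow_eq_coe]
            exact ⟨τ, h2, rfl⟩
          obtain ⟨σ', hσ', -⟩ := h3 x
          obtain ⟨τ', hτ', -⟩ := h4 x
          refine ⟨σ'.comp τ', by simp [run_append, hσ', hτ'], ?_⟩
          simp only [Subst.comp, occ_apply]
          refine Finset.sum_congr rfl fun z _ => ?_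
          obtain ⟨σ₂, e, hz⟩ := h3 z
          obtain ⟨τ₂, e', hz'⟩ := h4 z
          rw [hσ'] at e
          rw [hτ'] at e'
          simp only [Option.some.injEq, Prod.mk.injEq, true_and] at e e'
          rw [e, e', hz, hz']
    rw [FreeMonoid.toList_mul, FreeMonoid.toList_mul]
    exact S.flow_ext _ _ fun p x q y n =>
      ⟨key _ _ _ _ hu hv p x q y n, key _ _ _ _ hu.symm hv.symm p x q y n⟩

/-- The flow transition monoid of a streaming string transducer. -/
abbrev FlowTransitionMonoid (S : SST A B P X) : Type _ := S.flowCon.Quotient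

/-- A streaming string transducer is aperiodic if its flow transition monoid is. -/
def Aperiodic (S : SST A B P X) : Prop := IsAperiodicMonoid S.FlowTransitionMonoid

end SST

/-! ## Merge forests and the construction of the streaming string transducer -/

/-- A forest whose vertices are sets of states, the edges leading from a vertex to the smallest
vertex that strictly contains it, together with a partial mapping from vertices to states (constant
on each tree). -/
structure MergeForest (Q : Type*) where
  vertices : Set (Set Q)
  target : Set Q → Option Q

/-- The nodes of the graph in which a forest is extended by a letter: the vertices of the forest and
two copies of the states. -/
inductive Node (Q : Type*)
  | vert (s : Set Q)
  | inn (q : Q)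
  | out (q : Q)

/-- The first nodes `s, f s, f (f s), …` on the path from `s`, at most `k` of them. -/
def pathFrom {α : Type*} (f : α → Option α) : ℕ → α → List α
  | 0, _ => []
  | k + 1, s => s :: (match f s with
    | none => []
    | some t => pathFrom f k t)

namespace MergeForest

variable {Q : Type*}

/-- The empty forest. -/
def empty : MergeForest Q := ⟨∅, fun _ => none⟩

open Classical in
/-- The smallest vertex with a given property, if there is one. -/
noncomputable def least (G : MergeForest Q) (R : Set Q → Prop) : Option (Set Q) :=
  if h : ∃ t ∈ G.vertices, R t ∧ ∀ t' ∈ G.vertices, R t' → t ⊆ t' then some h.choose else none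

/-- The smallest vertex that contains the state `q`. -/
noncomputable def leaf (G : MergeForest Q) (q : Q) : Option (Set Q) := G.least fun t => q ∈ t

/-- The father of `s`: the smallest vertex that strictly contains `s`. -/
noncomputable def parent (G : MergeForest Q) (s : Set Q) : Option (Set Q) := G.least fun t => s ⊂ t

end MergeForest

namespace Transducer

variable {A B Q : Type*}

open Classical in
/-- The transition of `T` in state `p` on `a`, where on `⊣` a final state, in which `T` stops, exits
to the right without output. -/
noncomputable def exitδ (T : Transducer A B Q) (p : Q) : EndMarked A → Option (List B × Q × Move)
  | .rend => if p ∈ T.final then some ([], p, .right) else T.δ p .rend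
  | a => T.δ p a

open Classical in
/-- The unique outgoing edge, if any, of each node of the extension of the forest `G` by `a`. -/
noncomputable def next (T : Transducer A B Q) (G : MergeForest Q) (a : EndMarked A) :
    Node Q → Option (Node Q)
  | .vert s =>
    if s ∈ G.vertices then
      match G.parent s with
      | some t => some (.vert t)
      | none => (G.target s).map .inn
    else none
  | .inn p =>
    match T.exitδ p a with
    | none => none
    | some (_, q, .right) => some (.out q)
    | some (_, q, .stay) => some (.inn q)
    | some (_, q, .left) => (G.leaf q).map .vert
  | .out _ => none

/-- There is a path from `s` to `t` in the extension of `G` by `a`. -/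
def Path (T : Transducer A B Q) (G : MergeForest Q) (a : EndMarked A) (s t : Node Q) : Prop :=
  Relation.ReflTransGen (fun x y => T.next G a x = some y) s t

/-- The states `q` such that the node `s` lies on the path from `q` in the first copy. -/
def inSet (T : Transducer A B Q) (G : MergeForest Q) (a : EndMarked A) (s : Node Q) : Set Q :=
  {q | T.Path G a (.inn q) s}

open Classical in
/-- The reduction of the extension of `G` by `a`. -/
noncomputable def extend (T : Transducer A B Q) (G : MergeForest Q) (a : EndMarked A) :
    MergeForest Q where
  vertices := {t | t.Nonempty ∧ ∃ s q, T.inSet G a s = t ∧ T.Path G a s (.out q)}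
  target t :=
    if h : ∃ q s, t.Nonempty ∧ T.inSet G a s = t ∧ T.Path G a s (.out q)
    then some h.choose else none

/-- The forest of the word `⊢ w`. -/
noncomputable def forest (T : Transducer A B Q) (w : List A) : MergeForest Q :=
  (w.map EndMarked.letter).foldl T.extend (T.extend .empty .lend)

/-- The states of the streaming string transducer built from `T`: the forests of the words
`⊢ w`. -/
def SSTState (T : Transducer A B Q) : Type _ := {G : MergeForest Q // ∃ w, G = T.forest w}

instance SSTState.instFinite (T : Transducer A B Q) : Finite T.SSTState := by
  have := T.finite_states
  refine Finite.of_injective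
    (fun G : T.SSTState => ((G.1.vertices, G.1.target) : Set (Set Q) × (Set Q → Option Q))) ?_
  rintro ⟨⟨V, φ⟩, _⟩ ⟨⟨V', φ'⟩, _⟩ h
  simp only [Prod.mk.injEq] at h
  obtain ⟨rfl, rfl⟩ := h
  rfl

/-- The variables: `2 n - 1` of them if `T` has `n` states. -/
abbrev Var (_T : Transducer A B Q) : Type := Fin (2 * Nat.card Q - 1)

/-- An injective labeling, by variables, of the vertices of each forest that is a state. -/
def IsLabeling (T : Transducer A B Q) (lab : T.SSTState → Set Q → T.Var) : Prop :=
  ∀ G, Set.InjOn (lab G) G.1.vertices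

/-- A bound for the length of the paths that do not loop. -/
noncomputable def fuel (_T : Transducer A B Q) : ℕ := 2 ^ Nat.card Q + 2 * Nat.card Q

/-- The label of a node in the extension of a forest, the vertices of which are labeled by `l`. -/
noncomputable def nodeLabel (T : Transducer A B Q) (l : Set Q → T.Var) (a : EndMarked A) :
    Node Q → List (B ⊕ T.Var)
  | .vert s => [Sum.inr (l s)]
  | .inn p =>
    match T.exitδ p a with
    | none => []
    | some (v, _, _) => v.map Sum.inl
  | .out _ => []

open Classical in
/-- The label of a vertex `t` of the reduced extension of `G` by `a`: the concatenation of the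
labels of the nodes `s` with `inSet s = t`.  They follow each other on the path from any
state in `t`. -/
noncomputable def vertexLabel (T : Transducer A B Q) (G : MergeForest Q) (l : Set Q → T.Var)
    (a : EndMarked A) (t : Set Q) : List (B ⊕ T.Var) :=
  if h : t.Nonempty then
    ((pathFrom (T.next G a) T.fuel (.inn h.some)).filter fun s => T.inSet G a s = t).flatMap
      (T.nodeLabel l a)
  else []

/-- The successor of a state on the letter `a`. -/
noncomputable def succ (T : Transducer A B Q) (G : T.SSTState) (a : A) : T.SSTState :=
  ⟨T.extend G.1 (.letter a), by
    obtain ⟨_, w, rfl⟩ := G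
    exact ⟨w ++ [a], by simp [forest]⟩⟩

open Classical in
/-- The variable update: the variable of a vertex of the new forest is mapped to the label of this
vertex in the reduced extension, all other variables are mapped to the empty word. -/
noncomputable def update (T : Transducer A B Q) (lab : T.SSTState → Set Q → T.Var) (G : T.SSTState)
    (a : A) : Subst B T.Var := fun x =>
  if h : ∃ t ∈ (T.succ G a).1.vertices, lab (T.succ G a) t = x
  then T.vertexLabel G.1 (lab G) (.letter a) h.choose else []

open Classical in
/-- The output in the state `G`: if the run that enters from the right in the initial state exits in
a final state, the concatenation of the labels on its path in the reduced extension of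
`G` by `⊣`. -/
noncomputable def sstOut (T : Transducer A B Q) (lab : T.SSTState → Set Q → T.Var)
    (G : T.SSTState) : Option (List (B ⊕ T.Var)) :=
  match (T.extend G.1 .rend).leaf T.init with
  | none => none
  | some s =>
    if ∃ q ∈ T.final, (T.extend G.1 .rend).target s = some q then
      some ((pathFrom (T.extend G.1 .rend).parent T.fuel s).flatMap
        (T.vertexLabel G.1 (lab G) .rend))
    else none

/-- The streaming string transducer built from `T`, where `T` is meant to start on `⊣`
and to produce nothing on `⊢`. -/
noncomputable def toSST (T : Transducer A B Q) (lab : T.SSTState → Set Q → T.Var) :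
    SST A B T.SSTState T.Var where
  init := ⟨T.forest [], [], rfl⟩
  δ G a := some (T.succ G a, T.update lab G a)
  out := T.sstOut lab
  finite_states := inferInstance
  finite_vars := inferInstance

/-! ## Normalization -/

/-- `T` produces nothing on `⊢`. -/
def SilentAtLeft (T : Transducer A B Q) : Prop := ∀ p v q m, T.δ p .lend = some (v, q, m) → v = []

end Transducer

/-- States of the normalized machine: the states of the given machine, for each of
them a state that performs its transition on `⊢` one cell further to the right, and a state for
going to the left end. -/
inductive NormState (Q : Type*)
  | sim (q : Q)
  | emit (q : Q)
  | rewind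

instance NormState.instFinite {Q : Type*} [Finite Q] : Finite (NormState Q) := by
  refine Finite.of_surjective (fun x : Option (Q ⊕ Q) => match x with
    | none => NormState.rewind
    | some (.inl q) => .sim q
    | some (.inr q) => .emit q) ?_
  rintro (q | q | _)
  exacts [⟨some (.inl q), rfl⟩, ⟨some (.inr q), rfl⟩, ⟨none, rfl⟩]

namespace Transducer

variable {A B Q : Type*}

/-- Transitions of the normalized machine. -/
def normδ (T : Transducer A B Q) : NormState Q → EndMarked A → Option (List B × NormState Q × Move)
  | .sim p, .lend => (T.δ p .lend).map fun _ => ([], .emit p, .right)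
  | .sim p, .letter a => (T.δ p (.letter a)).map fun t => (t.1, .sim t.2.1, t.2.2)
  | .sim p, .rend => (T.δ p .rend).map fun t => (t.1, .sim t.2.1, t.2.2)
  | .emit _, .lend => none
  | .emit p, _ =>
    match T.δ p .lend with
    | none => none
    | some (v, q, .right) => some (v, .sim q, .stay)
    | some (v, q, _) => some (v, .sim q, .left)
  | .rewind, .lend => some ([], .sim T.init, .stay)
  | .rewind, _ => some ([], .rewind, .left)

/-- The normalized machine: it starts on `⊣`, goes to `⊢` and then simulates `T`; what `T` produces
on `⊢` is produced on the next cell instead. -/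
def normalize (T : Transducer A B Q) : Transducer A B (NormState Q) where
  init := .rewind
  final := NormState.sim '' T.final
  δ := T.normδ
  finite_states := by
    have := T.finite_states
    infer_instance
  lend_ne_left := by
    rintro (p | p | _) v q <;> simp [normδ]
  rend_ne_right := by
    rintro (p | p | _) v q h
    · simp only [normδ, Option.map_eq_some_iff, Prod.mk.injEq] at h
      obtain ⟨⟨v', q', m⟩, h, -, -, rfl⟩ := h
      exact T.rend_ne_right _ _ _ h
    · simp only [normδ] at h
      split at h <;> simp at h
    · simp [normδ] at h

end Transducer
end TwoWay

namespace TwoWay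

/-! ## Paths in graphs with at most one edge leaving each node -/

/-! On a fixed word the machine follows a graph with at most one edge leaving each configuration.
For a configuration `c` on a prefix `x` of the tape, consider the set of states in which `x` can be
entered from the right so as to reach `c`. These sets grow along runs, and two of them that meet are
nested, because their configurations lie on a common run. The nonempty sets of the configurations
from which the run leaves `x` to the right, together with the state of this exit, are the forest
`runForest` of `x`.

The heart of the proof is that the forests of the construction are exactly these
(`extend_runForest`, `forest_eq`). The graph that extends the forest of `x` by a letter `a`
simulates, up to stuttering, the configurations on `x a` (`isSimulation_corr`). Both forests arise
from their graphs by the same operation `reduct`, which does not see stuttering.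

The other properties are then read off from configurations. The variable of the vertex of `c` flows
to the variable of the vertex that the same `c` has over a longer word (`occ_runSubst`). Hence the
matrix of a nonempty word `u` is determined by the forests of the words `⊢ w u` and by the sets of
entries over `⊢ w u` of the configurations on `⊢ w`. Exits and sets of entries do not change when a
factor is replaced by one with the same behaviors, as long as the configuration is outside of this
factor (`reach_replace`). In powers of `u` with about twice the exponent of aperiodicity, there is
always such a factor that avoids a given configuration (`Aperiodic.toSST`).

As to outputs, the values of the variables on the path from a leaf to its root concatenate to the
output of the run that enters there (`IsValuation`). This invariant passes from `x` to `x a` because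
nodes with the same set of entries are consecutive on a path (`exists_parent_trace`). It holds at
`⊢` if nothing is produced there, which the normalization ensures while keeping transduction and
aperiodicity. Labelings exist because a laminar family of nonempty subsets of `n` states has at most
`2 n - 1` members (`ncard_laminar_le`). -/

/-- There is a path from `x` to `y` in the graph of the partial function `f`. -/
abbrev Reach {α : Type*} (f : α → Option α) : α → α → Prop :=
  Relation.ReflTransGen fun x y => f x = some y

/-- `l` lists the nodes of the maximal path from `x`, which is finite. -/
inductive Trace {α : Type*} (f : α → Option α) : α → List α → Prop
  | last (x : α) (h : f x = none) : Trace f x [x]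
  | step (x y : α) (l : List α) (h : f x = some y) (hl : Trace f y l) : Trace f x (x :: l)

section Graph

variable {α : Type*} {f : α → Option α} {x y z : α} {l l' : List α}

theorem Reach.total (h : Reach f x y) (h' : Reach f x z) : Reach f y z ∨ Reach f z y :=
  Relation.ReflTransGen.total_of_right_unique
    (fun a b c hb hc => by simpa [hb] using hc) h h'

theorem Reach.eq_of_none (hx : f x = none) (h : Reach f x y) : y = x := by
  rcases Relation.ReflTransGen.cases_head h with rfl | ⟨c, hc, -⟩
  · rfl
  · simp [hx] at hc

/-- Both paths follow the same edges, and neither can go on beyond the sink `z`; so `y` comes before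
`z`. -/
theorem Reach.of_terminal (hz : f z = none) (h : Reach f x z) (h' : Reach f x y) :
    Reach f y z := by
  rcases h.total h' with h1 | h1
  · rw [Reach.eq_of_none hz h1]
  · exact h1

theorem Reach.of_step (h : Reach f x z) (hxy : f x = some y) (hne : z ≠ x) : Reach f y z := by
  rcases Relation.ReflTransGen.cases_head h with rfl | ⟨c, hc, h⟩
  · exact absurd rfl hne
  · rw [hxy] at hc
    cases hc
    exact h

theorem Reach.terminal_unique (hy : f y = none) (hz : f z = none) (h : Reach f x y)
    (h' : Reach f x z) : y = z :=
  (Reach.eq_of_none hy (Reach.of_terminal hz h' h)).symm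

theorem Trace.unique (h : Trace f x l) (h' : Trace f x l') : l = l' := by
  induction h generalizing l' with
  | last x h =>
    cases h' with
    | last => rfl
    | step _ y l h2 => simp [h] at h2
  | step x y l h _ ih =>
    cases h' with
    | last _ h2 => simp [h] at h2
    | step _ y' l' h2 h3 =>
      rw [h] at h2
      cases h2
      rw [ih h3]

theorem Trace.mem_iff (h : Trace f x l) : y ∈ l ↔ Reach f x y := by
  induction h with
  | last x h =>
    rw [List.mem_singleton]
    exact ⟨fun e => e ▸ .refl, Reach.eq_of_none h⟩
  | step x z l h _ ih =>
    rw [List.mem_cons, ih]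
    constructor
    · rintro (rfl | h2)
      · exact .refl
      · exact .head h h2
    · intro h2
      by_cases e : y = x
      · exact .inl e
      · exact .inr (h2.of_step h e)

theorem Reach.exists_trace (h : Reach f x z) (hz : f z = none) : ∃ l, Trace f x l := by
  induction h using Relation.ReflTransGen.head_induction_on with
  | refl => exact ⟨_, .last _ hz⟩
  | head h _ ih =>
    obtain ⟨l, hl⟩ := ih
    exact ⟨_, .step _ _ _ h hl⟩

theorem Trace.exists_suffix (h : Trace f x l) (hy : Reach f x y) :
    ∃ l', Trace f y l' ∧ l'.length ≤ l.length := by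
  induction h with
  | last x h =>
    rw [Reach.eq_of_none h hy]
    exact ⟨_, .last _ h, le_rfl⟩
  | step x z l h hl ih =>
    by_cases e : y = x
    · subst e
      exact ⟨_, .step _ _ _ h hl, le_rfl⟩
    · obtain ⟨l', h1, h2⟩ := ih (hy.of_step h e)
      exact ⟨l', h1, h2.trans (by simp)⟩

/-- Finite maximal paths exclude cycles: if `x` were reachable from `y`, its trace would be no
longer than `l`, although it is `x :: l`. -/
theorem Trace.not_reach (hl : Trace f y l) (h : f x = some y) : ¬ Reach f y x := by
  intro hr
  obtain ⟨l', h1, h2⟩ := hl.exists_suffix hr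
  rw [Trace.unique h1 (.step _ _ _ h hl)] at h2
  simp at h2

theorem Trace.nodup (h : Trace f x l) : l.Nodup := by
  induction h with
  | last x h => simp
  | step x y l h hl ih =>
    rw [List.nodup_cons, hl.mem_iff]
    exact ⟨hl.not_reach h, ih⟩

theorem Trace.antisymm (h : Trace f x l) (hxy : Reach f x y) (hyx : Reach f y x) : x = y := by
  cases h with
  | last _ h => exact (Reach.eq_of_none h hxy).symm
  | step _ z l h hl =>
    by_contra hne
    exact hl.not_reach h ((hxy.of_step h (Ne.symm hne)).trans hyx)

/-- Removes the fuel from `pathFrom`; with `Trace.length_le` the number of nodes is always enough.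
-/
theorem Trace.pathFrom_eq (h : Trace f x l) {k : ℕ} (hk : l.length ≤ k) :
    pathFrom f k x = l := by
  induction h generalizing k with
  | last x h =>
    obtain ⟨k, rfl⟩ : ∃ j, k = j + 1 := ⟨k - 1, by simp at hk; omega⟩
    simp [pathFrom, h]
  | step x y l h _ ih =>
    obtain ⟨k, rfl⟩ : ∃ j, k = j + 1 := ⟨k - 1, by simp at hk; omega⟩
    simp only [pathFrom, h]
    rw [ih (by simpa using hk)]

theorem Trace.length_le [Finite α] (h : Trace f x l) : l.length ≤ Nat.card α := by
  have := Fintype.ofFinite α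
  rw [Nat.card_eq_fintype_card]
  exact h.nodup.length_le_card

end Graph

/-! ## The forest of a graph with entries and exits -/

theorem MergeForest.least_eq_some_iff {Q : Type*} {G : MergeForest Q} {R : Set Q → Prop}
    {t : Set Q} :
    G.least R = some t ↔ t ∈ G.vertices ∧ R t ∧ ∀ t' ∈ G.vertices, R t' → t ⊆ t' := by
  unfold MergeForest.least
  constructor
  · intro h
    split at h
    · rename_i hh
      cases h
      exact hh.choose_spec
    · cases h
  · rintro ⟨h1, h2, h3⟩
    have hh : ∃ t ∈ G.vertices, R t ∧ ∀ t' ∈ G.vertices, R t' → t ⊆ t' := ⟨t, h1, h2, h3⟩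
    rw [dif_pos hh]
    have := hh.choose_spec
    exact congrArg some ((this.2.2 t h1 h2).antisymm (h3 _ this.1 this.2.1))

/-- The entries from which there is a path to `s`. -/
def entries {α Q : Type*} (f : α → Option α) (e : Q → α) (s : α) : Set Q := {q | Reach f (e q) s}

open Classical in
/-- The forest of the sets of entries from which a node is reached, for the nodes from
which an exit is reached. -/
noncomputable def reduct {α Q : Type*} (f : α → Option α) (e o : Q → α) : MergeForest Q where
  vertices := {t | t.Nonempty ∧ ∃ s q, entries f e s = t ∧ Reach f s (o q)}
  target t :=
    if h : ∃ q s, t.Nonempty ∧ entries f e s = t ∧ Reach f s (o q)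
    then some h.choose else none

section Reduct

variable {α Q : Type*} {f : α → Option α} {e o : Q → α}

theorem entries_mono {s s' : α} (h : Reach f s s') : entries f e s ⊆ entries f e s' :=
  fun _ hq => Relation.ReflTransGen.trans hq h

theorem entries_mem_vertices {s : α} {q p : Q} (h : Reach f (e q) s) (h' : Reach f s (o p)) :
    entries f e s ∈ (reduct f e o).vertices :=
  ⟨⟨q, h⟩, s, p, rfl, h'⟩

/-- The exits are distinct nodes without outgoing edges. -/
structure IsExit (f : α → Option α) (o : Q → α) : Prop where
  none : ∀ q, f (o q) = none
  inj : Function.Injective o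

theorem IsExit.unique (ho : IsExit f o) {s : α} {p q : Q} (h : Reach f s (o p))
    (h' : Reach f s (o q)) : p = q :=
  ho.inj (Reach.terminal_unique (ho.none p) (ho.none q) h h')

theorem IsExit.reach (ho : IsExit f o) {s s' : α} {p : Q} (h : Reach f s (o p))
    (h' : Reach f s s') : Reach f s' (o p) :=
  Reach.of_terminal (ho.none p) h h'

theorem IsExit.exists_trace (ho : IsExit f o) {s : α} {p : Q} (h : Reach f s (o p)) :
    ∃ l, Trace f s l :=
  h.exists_trace (ho.none p)

/-- The chosen target does not depend on the choice: two nodes with the same nonempty set of entries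
lie on the path from a common entry, which has only one exit. -/
theorem reduct_target (ho : IsExit f o) {s : α} {q p : Q} (h : Reach f (e q) s)
    (h' : Reach f s (o p)) : (reduct f e o).target (entries f e s) = some p := by
  have hh : ∃ p' s', (entries f e s).Nonempty ∧ entries f e s' = entries f e s ∧
      Reach f s' (o p') := ⟨p, s, ⟨q, h⟩, rfl, h'⟩
  simp only [reduct]
  rw [dif_pos hh]
  obtain ⟨s', -, h2, h3⟩ := hh.choose_spec
  have hq : q ∈ entries f e s' := by rw [h2]; exact h
  exact congrArg some (ho.unique (Relation.ReflTransGen.trans hq h3) (h.trans h'))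

/-- The path from a common entry goes through both nodes, one of which therefore comes after the
other. -/
theorem reduct_laminar {s t : Set Q} (hs : s ∈ (reduct f e o).vertices)
    (ht : t ∈ (reduct f e o).vertices) {q : Q} (hqs : q ∈ s) (hqt : q ∈ t) : s ⊆ t ∨ t ⊆ s := by
  obtain ⟨-, s, _, rfl, -⟩ := hs
  obtain ⟨-, t, _, rfl, -⟩ := ht
  exact (Reach.total hqs hqt).imp entries_mono entries_mono

theorem reach_of_entries_ssubset {s s' : α} {q : Q} (h : Reach f (e q) s)
    (hss : entries f e s ⊂ entries f e s') : Reach f s s' := by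
  rcases Reach.total h (hss.1 h) with h1 | h1
  · exact h1
  · exact absurd (entries_mono h1) hss.2

/-- Every node reached from `e q` inherits all entries of `e q`, so the first node of the path gives
the least vertex. -/
theorem reduct_leaf {q p : Q} (h : Reach f (e q) (o p)) :
    (reduct f e o).leaf q = some (entries f e (e q)) := by
  refine MergeForest.least_eq_some_iff.2 ⟨entries_mem_vertices .refl h, .refl, ?_⟩
  rintro _ ⟨-, s, r, rfl, -⟩ hq
  exact entries_mono hq

theorem reduct_leaf_some {q : Q} {t : Set Q} (h : (reduct f e o).leaf q = some t) :
    t = entries f e (e q) ∧ ∃ p, Reach f (e q) (o p) := by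
  obtain ⟨⟨-, s, p, rfl, h1⟩, h2, -⟩ := MergeForest.least_eq_some_iff.1 h
  have h3 : Reach f (e q) (o p) := Relation.ReflTransGen.trans h2 h1
  refine ⟨?_, p, h3⟩
  rw [reduct_leaf h3] at h
  exact (Option.some.inj h).symm

/-- A vertex strictly larger than the set of `s` belongs to a node strictly after `s`, hence to one
reached from `s'`, and sets of entries grow along paths. -/
theorem reduct_parent {s s' : α} {q p : Q} (hs : Reach f (e q) s) (h : f s = some s')
    (h' : Reach f s' (o p)) (hne : entries f e s ≠ entries f e s') :
    (reduct f e o).parent (entries f e s) = some (entries f e s') := by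
  have h1 : Reach f s s' := .single h
  refine MergeForest.least_eq_some_iff.2 ⟨entries_mem_vertices (hs.trans h1) h',
    (entries_mono h1).ssubset_of_ne hne, ?_⟩
  rintro _ ⟨-, r, _, rfl, -⟩ hr
  refine entries_mono ((reach_of_entries_ssubset hs hr).of_step h ?_)
  rintro rfl
  exact hr.2 subset_rfl

theorem reduct_parent_some {s : α} {q : Q} {t : Set Q} (hs : Reach f (e q) s)
    (h : (reduct f e o).parent (entries f e s) = some t) :
    ∃ s' p, Reach f s s' ∧ Reach f s' (o p) ∧ t = entries f e s' := by
  obtain ⟨⟨-, s', p, rfl, h1⟩, h2, -⟩ := MergeForest.least_eq_some_iff.1 h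
  exact ⟨s', p, reach_of_entries_ssubset hs h2, h1, rfl⟩

/-- A father would belong to a node strictly after the exit, which is a sink. -/
theorem reduct_parent_exit (ho : IsExit f o) {q p : Q} (h : Reach f (e q) (o p)) :
    (reduct f e o).parent (entries f e (o p)) = none := by
  cases hp : (reduct f e o).parent (entries f e (o p)) with
  | none => rfl
  | some t =>
    obtain ⟨h0, h2, -⟩ := MergeForest.least_eq_some_iff.1 hp
    obtain ⟨s', p', h3, -, rfl⟩ := reduct_parent_some h hp
    rw [Reach.eq_of_none (ho.none p) h3] at h2
    exact absurd subset_rfl h2.2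

/-! ### Simulations up to stuttering preserve the forest -/

open Classical in
theorem dite_choose_congr {P P' : Q → Prop} (h : P = P') :
    (if h : ∃ q, P q then some h.choose else none) =
      if h : ∃ q, P' q then some h.choose else none := by
  subst h
  rfl

/-- A relation between the nodes of two graphs with entries and exits under which paths
correspond to each other up to stuttering. -/
structure IsSimulation {β : Type*} (f : α → Option α) (e o : Q → α) (g : β → Option β)
    (e' o' : Q → β) (ρ : α → β → Prop) : Prop where
  entry : ∀ q, ρ (e q) (e' q)
  exit_right : ∀ c p, ρ c (o' p) → c = o p
  exit_left : ∀ n p, ρ (o p) n → n = o' p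
  -- A configuration that never exits may have no counterpart; steps are matched only on paths to an
  -- exit.
  fwd : ∀ c n c' p, ρ c n → f c = some c' → Reach f c' (o p) →
    ∃ n', ρ c' n' ∧ Reach g n n'
  bwd : ∀ c n n', ρ c n → g n = some n' → ∃ c', ρ c' n' ∧ Reach f c c'
  functional : ∀ c n n', ρ c n → ρ c n' → n = n'
  entries_eq : ∀ c c' n, ρ c n → ρ c' n → entries f e c = entries f e c'

namespace IsSimulation

variable {β : Type*} {g : β → Option β} {e' o' : Q → β} {ρ : α → β → Prop}

theorem reach_fwd (S : IsSimulation f e o g e' o' ρ) {c c' : α} {n : β} {p : Q}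
    (hn : ρ c n) (h : Reach f c c') (hp : Reach f c' (o p)) : ∃ n', ρ c' n' ∧ Reach g n n' := by
  induction h with
  | refl => exact ⟨n, hn, .refl⟩
  | @tail a b _ h1 ih =>
    obtain ⟨n', h2, h3⟩ := ih (.head h1 hp)
    obtain ⟨n'', h4, h5⟩ := S.fwd _ _ _ p h2 h1 hp
    exact ⟨n'', h4, h3.trans h5⟩

theorem reach_bwd (S : IsSimulation f e o g e' o' ρ) {c : α} {n n' : β}
    (hn : ρ c n) (h : Reach g n n') : ∃ c', ρ c' n' ∧ Reach f c c' := by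
  induction h with
  | refl => exact ⟨c, hn, .refl⟩
  | @tail a b _ h1 ih =>
    obtain ⟨c', h2, h3⟩ := ih
    obtain ⟨c'', h4, h5⟩ := S.bwd _ _ _ h2 h1
    exact ⟨c'', h4, h3.trans h5⟩

theorem reach_exit_iff (S : IsSimulation f e o g e' o' ρ) {c : α} {n : β}
    (hn : ρ c n) (p : Q) : Reach f c (o p) ↔ Reach g n (o' p) := by
  constructor
  · intro h
    obtain ⟨n', h1, h2⟩ := S.reach_fwd (p := p) hn h .refl
    rwa [← S.exit_left _ _ h1]
  · intro h
    obtain ⟨c', h1, h2⟩ := S.reach_bwd hn h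
    rwa [← S.exit_right _ _ h1]

/-- Several configurations may be related to `n`. A path from an entry to `n` lifts to a path to one
of them, and by `entries_eq` it does not matter to which. -/
theorem entries_iff (S : IsSimulation f e o g e' o' ρ) {c : α} {n : β} {p : Q}
    (hn : ρ c n) (h : Reach f c (o p)) : entries g e' n = entries f e c := by
  ext q
  constructor
  · intro hq
    obtain ⟨c', h1, h2⟩ := S.reach_bwd (S.entry q) hq
    rw [S.entries_eq _ _ _ hn h1]
    exact h2
  · intro hq
    obtain ⟨n', h1, h2⟩ := S.reach_fwd (S.entry q) hq h
    rw [S.functional _ _ _ hn h1]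
    exact h2

theorem reduct_eq (S : IsSimulation f e o g e' o' ρ) :
    reduct g e' o' = reduct f e o := by
  have key : ∀ t p, (∃ s, t.Nonempty ∧ entries g e' s = t ∧ Reach g s (o' p)) ↔
      ∃ s, t.Nonempty ∧ entries f e s = t ∧ Reach f s (o p) := by
    intro t p
    constructor
    · rintro ⟨n, ⟨q, hq⟩, rfl, h⟩
      obtain ⟨c, h1, h2⟩ := S.reach_bwd (S.entry q) hq
      have h3 := (S.reach_exit_iff h1 p).2 h
      exact ⟨c, ⟨q, hq⟩, (S.entries_iff h1 h3).symm, h3⟩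
    · rintro ⟨c, ⟨q, hq⟩, rfl, h⟩
      obtain ⟨n, h1, h2⟩ := S.reach_fwd (S.entry q) hq h
      exact ⟨n, ⟨q, hq⟩, S.entries_iff h1 h, (S.reach_exit_iff h1 p).1 h⟩
  unfold reduct
  congr 1
  · ext t
    constructor
    · rintro ⟨h, s, p, h1, h2⟩
      obtain ⟨c, h3, h4, h5⟩ := (key t p).1 ⟨s, h, h1, h2⟩
      exact ⟨h, c, p, h4, h5⟩
    · rintro ⟨h, s, p, h1, h2⟩
      obtain ⟨c, h3, h4, h5⟩ := (key t p).2 ⟨s, h, h1, h2⟩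
      exact ⟨h, c, p, h4, h5⟩
  · funext t
    exact dite_choose_congr (funext fun p => propext (key t p))

end IsSimulation

/-! ### Labels of the vertices -/

section Labels

variable {C : Type*} (lab : α → List C)

open Classical in
/-- The nodes with set of entries `t` on the path from any element of `t` are the same. -/
theorem Trace.filter_entries_eq {q q' : Q} {l l' : List α}
    (hl : Trace f (e q) l) (hl' : Trace f (e q') l') {t : Set Q}
    (hq : q ∈ t) (hq' : q' ∈ t) :
    l.filter (fun s => entries f e s = t) = l'.filter fun s => entries f e s = t := by
  -- Generalized to any two starting nodes that reach the same nodes with set `t`. Nodes with other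
  -- sets are dropped from the front of both lists; the first nodes that remain reach each other and
  -- are equal by antisymmetry.
  have aux : ∀ {c d : α} {k k' : List α}, Trace f c k → Trace f d k' →
      (∀ s, entries f e s = t → Reach f c s → Reach f d s) →
      (∀ s, entries f e s = t → Reach f d s → Reach f c s) →
      k.filter (fun s => entries f e s = t) = k'.filter fun s => entries f e s = t := by
    intro c d k k' hk
    induction hk generalizing d k' with
    | last c hc =>
      intro hk'
      induction hk' with
      | last d hd =>
        intro h1 h2
        by_cases hct : entries f e c = t
        · rw [Reach.eq_of_none hd (h1 c hct .refl)]
        · by_cases hdt : entries f e d = t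
          · exact absurd (by rwa [← Reach.eq_of_none hc (h2 d hdt .refl)]) hct
          · simp [hct, hdt]
      | step d d' k' hd hk' ih =>
        intro h1 h2
        by_cases hdt : entries f e d = t
        · have := Reach.eq_of_none hc (h2 d hdt .refl)
          subst this
          rw [hc] at hd
          cases hd
        · rw [List.filter_cons_of_neg (a := d) (by simpa using hdt)]
          refine ih (fun s hs h => ?_) (fun s hs h => h2 s hs (.head hd h))
          refine (h1 s hs h).of_step hd ?_
          rintro rfl
          exact hdt hs
    | step c c' k hc hk ih =>
      intro hk' h1 h2
      by_cases hct : entries f e c = t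
      · clear ih
        induction hk' with
        | last d hd =>
          have := Reach.eq_of_none hd (h1 c hct .refl)
          subst this
          rw [hc] at hd
          cases hd
        | step d d' k' hd hk' ih' =>
          by_cases hdt : entries f e d = t
          · have hcd := Trace.antisymm (.step _ _ _ hc hk) (h2 d hdt .refl) (h1 c hct .refl)
            subst hcd
            rw [Trace.unique (.step _ _ _ hc hk) (.step _ _ _ hd hk')]
          · rw [List.filter_cons_of_neg (a := d) (by simpa using hdt)]
            refine ih' (fun s hs h => ?_) (fun s hs h => h2 s hs (.head hd h))
            refine (h1 s hs h).of_step hd ?_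
            rintro rfl
            exact hdt hs
      · rw [List.filter_cons_of_neg (by simpa using hct)]
        refine ih hk' (fun s hs h => h1 s hs (.head hc h)) (fun s hs h => ?_)
        refine (h2 s hs h).of_step hc ?_
        rintro rfl
        exact hct hs
  refine aux hl hl' (fun s hs _ => ?_) (fun s hs _ => ?_)
  · rw [← hs] at hq'; exact hq'
  · rw [← hs] at hq; exact hq

-- Sets of entries grow along a path, so the nodes with a given set form a block, and the successive
-- blocks correspond to the vertices from the leaf up to the root. Concatenating labels block by
-- block gives back the labels of the whole path. In this way the output of a run is distributed
-- over the vertices.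
open Classical in
theorem exists_parent_trace (ho : IsExit f o) {c : α} {q p : Q} {l : List α}
    (hl : Trace f c l) (hq : Reach f (e q) c) (hp : Reach f c (o p)) :
    ∃ k, Trace (reduct f e o).parent (entries f e c) k ∧
      (∀ t ∈ k, entries f e c ⊆ t ∧ t ∈ (reduct f e o).vertices) ∧
      k.flatMap (fun t => (l.filter fun s => entries f e s = t).flatMap lab) = l.flatMap lab := by
  induction hl with
  | last c hc =>
    have := Reach.eq_of_none hc hp
    subst this
    refine ⟨[_], .last _ (reduct_parent_exit ho hq), ?_, by simp⟩
    intro t ht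
    rw [List.mem_singleton] at ht
    subst ht
    exact ⟨subset_rfl, entries_mem_vertices hq hp⟩
  | step c c' l hc hl ih =>
    have hp' : Reach f c' (o p) := ho.reach hp (.single hc)
    obtain ⟨k, hk, h1, h2⟩ := ih (hq.trans (.single hc)) hp'
    have hsub : entries f e c ⊆ entries f e c' := entries_mono (.single hc)
    -- Either `c` joins the block of `c'`, or it forms a block of its own, since no later node has
    -- its set of entries.
    by_cases hne : entries f e c = entries f e c'
    · rw [hne]
      refine ⟨k, hk, h1, ?_⟩
      have hk' : ∃ k', k = entries f e c' :: k' := by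
        cases hk with
        | last => exact ⟨_, rfl⟩
        | step => exact ⟨_, rfl⟩
      obtain ⟨k', rfl⟩ := hk'
      have hnd := hk.nodup
      rw [List.flatMap_cons] at h2 ⊢
      rw [List.flatMap_cons, ← h2, List.filter_cons_of_pos (by simpa using hne), List.flatMap_cons,
        List.append_assoc]
      congr 2
      refine List.flatMap_congr fun t ht => ?_
      rw [List.filter_cons_of_neg]
      simp only [decide_eq_true_eq]
      rintro rfl
      rw [hne] at ht
      exact (List.nodup_cons.1 hnd).1 ht
    · refine ⟨entries f e c :: k, .step _ _ _ (reduct_parent hq hc hp' hne) hk, ?_, ?_⟩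
      · intro t ht
        rcases List.mem_cons.1 ht with rfl | ht
        · exact ⟨subset_rfl, entries_mem_vertices hq hp⟩
        · exact ⟨hsub.trans (h1 t ht).1, (h1 t ht).2⟩
      · rw [List.flatMap_cons, List.filter_cons_of_pos (by simp), List.flatMap_cons,
          List.flatMap_cons, List.append_assoc, ← h2]
        congr 1
        have h3 : l.filter (fun s => entries f e s = entries f e c) = [] := by
          rw [List.filter_eq_nil_iff]
          intro s hs
          simp only [decide_eq_true_eq]
          intro h4
          rw [hl.mem_iff] at hs
          exact hne (hsub.antisymm (h4 ▸ entries_mono hs))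
        rw [h3, List.flatMap_nil, List.nil_append]
        refine List.flatMap_congr fun t ht => ?_
        rw [List.filter_cons_of_neg]
        simp only [decide_eq_true_eq]
        rintro rfl
        exact hne (hsub.antisymm (h1 _ ht).1)

end Labels

end Reduct
/-! ## Configurations -/

/-- The cells of a word over the extended alphabet, at positions `1, …, |x|`. -/
def cell {A : Type*} (x : List (EndMarked A)) : ℕ → Option (EndMarked A)
  | 0 => none
  | i + 1 => x[i]?

/-- The configurations: the machine reads the cell at position `i` in state `q`, or it has just
moved to the right from this cell into state `q`. -/
inductive Conf (Q : Type*)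
  | rd (q : Q) (i : ℕ)
  | ex (q : Q) (i : ℕ)

namespace Conf

variable {Q : Type*}

def pos : Conf Q → ℕ
  | rd _ i => i
  | ex _ i => i

def shift (k : ℕ) : Conf Q → Conf Q
  | rd q i => rd q (k + i)
  | ex q i => ex q (k + i)

end Conf

/-- The configuration after a transition at position `i` into state `q`. -/
def Move.conf {Q : Type*} : Move → Q → ℕ → Conf Q
  | .left, q, i => .rd q (i - 1)
  | .stay, q, i => .rd q i
  | .right, q, i => .ex q i

section Cells

variable {A : Type*}

theorem cell_pos {x : List (EndMarked A)} {i : ℕ} {a : EndMarked A} (h : cell x i = some a) :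
    1 ≤ i ∧ i ≤ x.length := by
  cases i with
  | zero => simp [cell] at h
  | succ i =>
    have := (List.getElem?_eq_some_iff.1 h).1
    omega

theorem cell_append_left {x : List (EndMarked A)} (y : List (EndMarked A)) {i : ℕ}
    (h : i ≤ x.length) : cell (x ++ y) i = cell x i := by
  cases i with
  | zero => rfl
  | succ i => exact List.getElem?_append_left h

theorem cell_append_right (x y : List (EndMarked A)) {i : ℕ} (h : 1 ≤ i) :
    cell (x ++ y) (x.length + i) = cell y i := by
  obtain ⟨i, rfl⟩ : ∃ j, i = j + 1 := ⟨i - 1, by omega⟩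
  rw [← Nat.add_assoc]
  simp only [cell]
  rw [List.getElem?_append_right (by simp)]
  simp

theorem cell_last (x : List (EndMarked A)) (a : EndMarked A) :
    cell (x ++ [a]) (x.length + 1) = some a := by
  rw [cell_append_right _ _ le_rfl]
  rfl

theorem wordCell_eq (u : List A) : wordCell u = cell (u.map EndMarked.letter) := by
  funext i
  cases i <;> rfl

end Cells

namespace Transducer

variable {A B Q : Type*} (T : Transducer A B Q)

/-- The step function on configurations; final states move to the right from `⊣`. -/
noncomputable def cstep (x : List (EndMarked A)) : Conf Q → Option (Conf Q)
  | .rd p i => (cell x i).bind fun a => (T.exitδ p a).map fun t => t.2.2.conf t.2.1 i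
  | .ex p i => if i < x.length then some (.rd p (i + 1)) else none

variable {T} {x y : List (EndMarked A)} {p q : Q} {i : ℕ} {c d : Conf Q}

theorem cstep_rd_iff : T.cstep x (.rd p i) = some c ↔
    ∃ a v q m, cell x i = some a ∧ T.exitδ p a = some (v, q, m) ∧ c = m.conf q i := by
  simp only [cstep, Option.bind_eq_some_iff, Option.map_eq_some_iff, Prod.exists]
  constructor
  · rintro ⟨a, h, v, q, m, h1, rfl⟩
    exact ⟨a, v, q, m, h, h1, rfl⟩
  · rintro ⟨a, v, q, m, h, h1, rfl⟩
    exact ⟨a, h, v, q, m, h1, rfl⟩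

theorem cstep_ex (h : i < x.length) : T.cstep x (.ex p i) = some (.rd p (i + 1)) := by
  simp [cstep, h]

theorem cstep_ex_iff : T.cstep x (.ex p i) = some c ↔ i < x.length ∧ c = .rd p (i + 1) := by
  simp [cstep, eq_comm]

theorem Move.conf_pos (m : Move) (q : Q) (i : ℕ) : (m.conf q i).pos ≤ i := by
  cases m <;> simp [Move.conf, Conf.pos]

theorem cstep_pos (h : T.cstep x c = some d) : c.pos ≤ x.length ∧ d.pos ≤ x.length := by
  cases c with
  | rd p i =>
    obtain ⟨a, v, q, m, h1, -, rfl⟩ := cstep_rd_iff.1 h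
    exact ⟨(cell_pos h1).2, (Move.conf_pos m q i).trans (cell_pos h1).2⟩
  | ex p i =>
    obtain ⟨h1, rfl⟩ := cstep_ex_iff.1 h
    exact ⟨h1.le, h1⟩

theorem reach_pos (h : Reach (T.cstep x) c d) (hc : c.pos ≤ x.length) : d.pos ≤ x.length := by
  induction h with
  | refl => exact hc
  | tail _ h _ => exact (cstep_pos h).2

theorem cstep_shift (y x z : List (EndMarked A)) (h : T.cstep x c = some d) :
    T.cstep (y ++ (x ++ z)) (c.shift y.length) = some (d.shift y.length) := by
  cases c with
  | rd p i =>
    obtain ⟨a, v, q, m, h1, h2, rfl⟩ := cstep_rd_iff.1 h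
    refine cstep_rd_iff.2 ⟨a, v, q, m, ?_, h2, ?_⟩
    · rw [cell_append_right _ _ (cell_pos h1).1, cell_append_left _ (cell_pos h1).2, h1]
    · have := (cell_pos h1).1
      cases m <;> simp only [Move.conf, Conf.shift, Conf.rd.injEq, true_and]
      omega
  | ex p i =>
    obtain ⟨h1, rfl⟩ := cstep_ex_iff.1 h
    exact cstep_ex_iff.2 ⟨by simp only [List.length_append]; omega, rfl⟩

theorem reach_shift (y x z : List (EndMarked A)) (h : Reach (T.cstep x) c d) :
    Reach (T.cstep (y ++ (x ++ z))) (c.shift y.length) (d.shift y.length) :=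
  Relation.ReflTransGen.lift (Conf.shift y.length) (fun _ _ h => cstep_shift y x z h) _ _ h

theorem Conf.shift_zero (c : Conf Q) : c.shift 0 = c := by
  cases c <;> simp [Conf.shift]

theorem cstep_append (y : List (EndMarked A)) (h : T.cstep x c = some d) :
    T.cstep (x ++ y) c = some d := by
  simpa [Conf.shift_zero] using cstep_shift [] x y h

theorem reach_append (y : List (EndMarked A)) (h : Reach (T.cstep x) c d) :
    Reach (T.cstep (x ++ y)) c d :=
  Relation.ReflTransGen.mono (fun _ _ => cstep_append y) _ _ h

/-- A move to the right takes two steps, through an `ex` configuration. So the border is crossed to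
the right by one kind of step only, and the configurations at which `x` is left do not depend on
what follows `x`. -/
theorem cstep_of_append (h : T.cstep (x ++ y) c = some d) (hc : c.pos ≤ x.length) :
    T.cstep x c = some d ∨ ∃ r, c = .ex r x.length ∧ d = .rd r (x.length + 1) := by
  cases c with
  | rd p i =>
    obtain ⟨a, v, q, m, h1, h2, rfl⟩ := cstep_rd_iff.1 h
    exact .inl (cstep_rd_iff.2 ⟨a, v, q, m, by rwa [cell_append_left y (i := i) hc] at h1, h2, rfl⟩)
  | ex p i =>
    obtain ⟨h1, rfl⟩ := cstep_ex_iff.1 h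
    rcases Nat.lt_or_eq_of_le hc with h2 | h2
    · exact .inl (cstep_ex h2)
    · simp only [Conf.pos] at h2
      subst h2
      exact .inr ⟨p, rfl, rfl⟩

/-- A path that leaves `x` to the right passes through an exit. -/
theorem reach_leave (h : Reach (T.cstep (x ++ y)) c d) (hc : c.pos ≤ x.length)
    (hd : x.length < d.pos) :
    ∃ r, Reach (T.cstep x) c (.ex r x.length) ∧ Reach (T.cstep (x ++ y)) (.ex r x.length) d := by
  induction h using Relation.ReflTransGen.head_induction_on with
  | refl => omega
  | @head c c' h1 h2 ih =>
    rcases cstep_of_append h1 hc with h3 | ⟨r, rfl, -⟩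
    · obtain ⟨r, h4, h5⟩ := ih (cstep_pos h3).2
      exact ⟨r, .head h3 h4, h5⟩
    · exact ⟨r, .refl, .head h1 h2⟩

/-- A path that comes from the right into `x` enters it in its last cell. -/
theorem reach_enter (h : Reach (T.cstep (x ++ y)) c d) (hc : x.length < c.pos)
    (hd : d.pos ≤ x.length) : ∃ p, Reach (T.cstep (x ++ y)) c (.rd p x.length) ∧
      Reach (T.cstep x) (.rd p x.length) d := by
  induction h with
  | refl => omega
  | @tail d' d h1 h2 ih =>
    by_cases hd' : d'.pos ≤ x.length
    · rcases cstep_of_append h2 hd' with h3 | ⟨r, rfl, rfl⟩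
      · obtain ⟨p, h4, h5⟩ := ih hd'
        exact ⟨p, h4, h5.tail h3⟩
      · simp only [Conf.pos] at hd
        omega
    · have : ∃ p, d = .rd p x.length := by
        cases d' with
        | rd p i =>
          obtain ⟨a, v, q, m, -, -, rfl⟩ := cstep_rd_iff.1 h2
          refine ⟨q, ?_⟩
          cases m <;> simp only [Conf.pos, Move.conf, Conf.rd.injEq, true_and] at * <;> omega
        | ex p i =>
          obtain ⟨-, rfl⟩ := cstep_ex_iff.1 h2
          simp only [Conf.pos] at *
          omega
      obtain ⟨p, rfl⟩ := this
      exact ⟨p, h1.tail h2, .refl⟩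

variable (T) in
/-- The states in which the machine can enter `x` from the right so as to reach `c`. -/
abbrev confEntries (x : List (EndMarked A)) (c : Conf Q) : Set Q :=
  entries (T.cstep x) (fun q => .rd q x.length) c

variable (T) in
/-- The forest of the word `x`, in terms of the configurations on `x`. -/
noncomputable abbrev runForest (x : List (EndMarked A)) : MergeForest Q :=
  reduct (T.cstep x) (fun q => .rd q x.length) fun q => .ex q x.length

variable (T x) in
theorem isExit_cstep : IsExit (T.cstep x) fun q => .ex q x.length where
  none q := by simp [cstep]
  inj p q h := by simpa using h

/-- A run from the right end to `c` enters `x` a last time from the right. Thus the set over `x y`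
depends on `c` only through the set over `x`, which is why sets of entries suffice as the memory of
a one-way machine. -/
theorem confEntries_append (hc : c.pos ≤ x.length) : T.confEntries (x ++ y) c =
    {q | ∃ p ∈ T.confEntries x c, Reach (T.cstep (x ++ y)) (.rd q (x ++ y).length)
      (.rd p x.length)} := by
  ext q
  constructor
  · intro h
    by_cases hy : y = []
    · subst hy
      simp only [List.append_nil, Set.mem_ofPred_eq] at h ⊢
      exact ⟨q, h, .refl⟩
    · have hy' := List.length_pos_of_ne_nil hy
      obtain ⟨p, h1, h2⟩ := reach_enter h (by simp [Conf.pos]; omega) hc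
      exact ⟨p, h2, h1⟩
  · rintro ⟨p, h1, h2⟩
    exact h2.trans (reach_append y h1)

/-! ### The extension of a forest -/

theorem next_vert_iff {G : MergeForest Q} {a : EndMarked A} {s : Set Q} {n : Node Q} :
    T.next G a (.vert s) = some n ↔ s ∈ G.vertices ∧
      ((∃ t, G.parent s = some t ∧ n = .vert t) ∨
        G.parent s = none ∧ ∃ r, G.target s = some r ∧ n = .inn r) := by
  simp only [next]
  split_ifs with h
  · cases hp : G.parent s with
    | none => simp [h, eq_comm]
    | some t => simp [h, eq_comm]
  · simp [h]

theorem next_inn_iff {G : MergeForest Q} {a : EndMarked A} {n : Node Q} :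
    T.next G a (.inn p) = some n ↔ ∃ v q m, T.exitδ p a = some (v, q, m) ∧
      (m = .right ∧ n = .out q ∨ m = .stay ∧ n = .inn q ∨
        m = .left ∧ ∃ t, G.leaf q = some t ∧ n = .vert t) := by
  simp only [next]
  constructor
  · intro h
    split at h
    · cases h
    · rename_i v q h1
      exact ⟨v, q, _, h1, .inl ⟨rfl, by simpa [eq_comm] using h⟩⟩
    · rename_i v q h1
      exact ⟨v, q, _, h1, .inr (.inl ⟨rfl, by simpa [eq_comm] using h⟩)⟩
    · rename_i v q h1
      refine ⟨v, q, _, h1, .inr (.inr ⟨rfl, ?_⟩)⟩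
      obtain ⟨t, h2, rfl⟩ := Option.map_eq_some_iff.1 h
      exact ⟨t, h2, rfl⟩
  · rintro ⟨v, q, m, h1, (⟨rfl, rfl⟩ | ⟨rfl, rfl⟩ | ⟨rfl, t, h2, rfl⟩)⟩
    · simp [h1]
    · simp [h1]
    · simp [h1, h2]

theorem isExit_next (G : MergeForest Q) (a : EndMarked A) : IsExit (T.next G a) Node.out where
  none q := by simp [next]
  inj p q h := by simpa using h

theorem extend_eq (G : MergeForest Q) (a : EndMarked A) :
    T.extend G a = reduct (T.next G a) Node.inn Node.out := rfl

/-- The correspondence of configurations on `x a` with the nodes of the extension by `a` of the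
forest of `x`. -/
def Corr (T : Transducer A B Q) (x : List (EndMarked A)) (c : Conf Q) : Node Q → Prop
  | .vert s => c.pos ≤ x.length ∧ T.confEntries x c = s ∧ s.Nonempty ∧
      ∃ p, Reach (T.cstep x) c (.ex p x.length)
  | .inn q => c = .rd q (x.length + 1)
  | .out q => c = .ex q (x.length + 1)

/-- A vertex stands for all configurations on `x` with this set of entries from which `x` is left to
the right. A step on `x` keeps the set, and then the node does not change, or it leads to the
father. From the root the run leaves `x` in the state attached to the tree and goes on at `a`. -/
theorem isSimulation_corr (T : Transducer A B Q) (x : List (EndMarked A)) (a : EndMarked A) :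
    IsSimulation (T.cstep (x ++ [a])) (fun q => .rd q (x ++ [a]).length)
      (fun q => .ex q (x ++ [a]).length) (T.next (T.runForest x) a) Node.inn Node.out
      (T.Corr x) := by
  have ho := isExit_cstep T x
  constructor
  · intro q
    simp [Corr]
  · intro c p h
    simpa [Corr] using h
  · rintro (s | q | q) p h
    · have := h.1
      simp [Conf.pos] at this
    · simp [Corr] at h
    · simp only [Corr, Conf.ex.injEq] at h
      rw [h.1]
  · rintro c (s | q | q) c' p h h1 h2
    · obtain ⟨hc, rfl, ⟨q, hq⟩, r, hr⟩ := h
      rcases cstep_of_append h1 hc with h3 | ⟨r', rfl, rfl⟩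
      · have hr' := ho.reach hr (.single h3)
        have hq' := Relation.ReflTransGen.tail hq h3
        refine ⟨.vert (T.confEntries x c'), ⟨(cstep_pos h3).2, rfl, ⟨q, hq'⟩, r, hr'⟩, ?_⟩
        by_cases hne : T.confEntries x c = T.confEntries x c'
        · rw [hne]
        · refine .single (next_vert_iff.2 ⟨entries_mem_vertices hq hr, .inl ⟨_, ?_, rfl⟩⟩)
          exact reduct_parent hq h3 hr' hne
      · refine ⟨.inn r', rfl, .single (next_vert_iff.2 ⟨entries_mem_vertices hq hr, .inr ⟨?_, _,
          ?_, rfl⟩⟩)⟩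
        · exact reduct_parent_exit ho hq
        · exact reduct_target ho hq .refl
    · simp only [Corr] at h
      subst h
      obtain ⟨a', v, q', m, h3, h4, rfl⟩ := cstep_rd_iff.1 h1
      rw [cell_last] at h3
      cases h3
      cases m with
      | right => exact ⟨.out q', rfl, .single (next_inn_iff.2 ⟨v, q', _, h4, by simp⟩)⟩
      | stay => exact ⟨.inn q', rfl, .single (next_inn_iff.2 ⟨v, q', _, h4, by simp⟩)⟩
      | left =>
        simp only [Move.conf, Nat.add_sub_cancel] at h2 ⊢
        -- The run exits from `x a`, so it has to come out of `x` again; hence the least vertex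
        -- containing `q'` exists.
        obtain ⟨r, h5, -⟩ := reach_leave h2 le_rfl (by simp [Conf.pos])
        refine ⟨.vert (T.confEntries x (.rd q' x.length)), ⟨le_rfl, rfl, ⟨q', .refl⟩, r, h5⟩,
          .single (next_inn_iff.2 ⟨v, q', _, h4, .inr (.inr ⟨rfl, _, ?_, rfl⟩)⟩)⟩
        exact reduct_leaf (e := fun q => Conf.rd q x.length) h5
    · simp only [Corr] at h
      subst h
      simp [cstep] at h1
  · rintro c (s | q | q) n' h h1
    · obtain ⟨hc, rfl, ⟨q, hq⟩, r, hr⟩ := h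
      obtain ⟨-, (⟨t, h2, rfl⟩ | ⟨h2, r', h3, rfl⟩)⟩ := next_vert_iff.1 h1
      · obtain ⟨c', p, h3, h4, rfl⟩ :=
          reduct_parent_some (e := fun q => Conf.rd q x.length) hq h2
        exact ⟨c', ⟨reach_pos h3 hc, rfl, ⟨q, Relation.ReflTransGen.trans hq h3⟩, p, h4⟩,
          reach_append _ h3⟩
      · rw [reduct_target (e := fun q => Conf.rd q x.length) ho hq hr] at h3
        cases h3
        exact ⟨_, rfl, (reach_append _ hr).tail (cstep_ex (by simp))⟩
    · simp only [Corr] at h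
      subst h
      obtain ⟨v, q', m, h2, h3⟩ := next_inn_iff.1 h1
      have hs : T.cstep (x ++ [a]) (.rd q (x.length + 1)) = some (m.conf q' (x.length + 1)) :=
        cstep_rd_iff.2 ⟨a, v, q', m, cell_last x a, h2, rfl⟩
      rcases h3 with ⟨rfl, rfl⟩ | ⟨rfl, rfl⟩ | ⟨rfl, t, h3, rfl⟩
      · exact ⟨_, rfl, .single hs⟩
      · exact ⟨_, rfl, .single hs⟩
      · obtain ⟨rfl, p, h4⟩ := reduct_leaf_some h3
        exact ⟨_, ⟨le_rfl, rfl, ⟨q', .refl⟩, p, h4⟩, .single hs⟩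
    · simp [next] at h1
  · rintro c (s | q | q) (s' | q' | q') h h'
    · rw [← h.2.1, ← h'.2.1]
    all_goals try simp only [Corr] at h h'
    all_goals first
      | (obtain ⟨h, -⟩ := h; subst h'; simp [Conf.pos] at h)
      | (obtain ⟨h', -⟩ := h'; subst h; simp [Conf.pos] at h')
      | (subst h; simp at h' <;> rw [h'])
  · rintro c c' (s | q | q) h h'
    · have h1 := confEntries_append (T := T) (y := [a]) h.1
      have h2 := confEntries_append (T := T) (y := [a]) h'.1
      rw [h.2.1] at h1
      rw [h'.2.1] at h2
      exact h1.trans h2.symm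
    · simp only [Corr] at h h'
      rw [h, h']
    · simp only [Corr] at h h'
      rw [h, h']

theorem extend_runForest (T : Transducer A B Q) (x : List (EndMarked A)) (a : EndMarked A) :
    T.extend (T.runForest x) a = T.runForest (x ++ [a]) :=
  (isSimulation_corr T x a).reduct_eq

/-- An entry into the empty word is stuck at once, and it is not an exit. -/
theorem runForest_nil (T : Transducer A B Q) : T.runForest [] = .empty := by
  have key : ∀ t p, ¬ ∃ s, t.Nonempty ∧ T.confEntries [] s = t ∧
      Reach (T.cstep []) s (.ex p 0) := by
    rintro _ p ⟨s, ⟨q, hq⟩, rfl, h⟩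
    have := Reach.eq_of_none (f := T.cstep []) (x := .rd q 0) (by simp [cstep, cell])
      (Relation.ReflTransGen.trans hq h)
    cases this
  unfold runForest reduct MergeForest.empty
  congr 1
  · rw [Set.eq_empty_iff_forall_notMem]
    rintro t ⟨h, s, p, h1, h2⟩
    exact key t p ⟨s, h, h1, h2⟩
  · funext t
    rw [dif_neg]
    rintro ⟨p, s, h⟩
    exact key t p ⟨s, h⟩

/-- The extended word `⊢ w`. -/
def leftMarked (w : List A) : List (EndMarked A) := .lend :: w.map .letter

theorem leftMarked_append (w u : List A) :
    leftMarked (w ++ u) = leftMarked w ++ u.map .letter := by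
  simp [leftMarked]

theorem forest_eq (T : Transducer A B Q) (w : List A) :
    T.forest w = T.runForest (leftMarked w) := by
  induction w using List.reverseRecOn with
  | nil => rw [forest, ← runForest_nil, extend_runForest]; rfl
  | append_singleton w a ih =>
    rw [leftMarked_append, List.map_singleton, ← extend_runForest, ← ih]
    simp [forest]

end Transducer
/-! ## Occurrences of variables -/

section Occ

variable {B X α : Type*}

theorem occ_nil (x : X) : occ x ([] : List (B ⊕ X)) = 0 := by simp [occ]

theorem occ_append (x : X) (l l' : List (B ⊕ X)) : occ x (l ++ l') = occ x l + occ x l' := by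
  simp [occ]

open Classical in
theorem occ_var (x y : X) : occ x ([Sum.inr y] : List (B ⊕ X)) = if y = x then 1 else 0 := by
  simp [occ]

theorem occ_eq_zero {x : X} {l : List (B ⊕ X)} (h : Sum.inr x ∉ l) : occ x l = 0 := by
  classical
  induction l with
  | nil => exact occ_nil x
  | cons a l ih =>
    rw [← List.singleton_append, occ_append, ih fun h' => h (List.mem_cons_of_mem _ h')]
    cases a with
    | inl b => simp [occ]
    | inr y =>
      rw [occ_var, if_neg]
      rintro rfl
      simp at h

open Classical in
theorem occ_flatMap {x : X} {f : α → List (B ⊕ X)} {l : List α} (hl : l.Nodup) (n : α)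
    (h : ∀ m ∈ l, occ x (f m) = if m = n then 1 else 0) :
    occ x (l.flatMap f) = if n ∈ l then 1 else 0 := by
  induction l with
  | nil => simp [occ_nil]
  | cons a l ih =>
    rw [List.nodup_cons] at hl
    rw [List.flatMap_cons, occ_append, h a (by simp),
      ih hl.2 fun m hm => h m (List.mem_cons_of_mem _ hm)]
    by_cases ha : a = n
    · subst ha
      simp [hl.1]
    · simp [ha, Ne.symm ha]

end Occ

/-! ### The number of nodes, which is the fuel, and exits from vertices -/

instance {Q : Type*} [Finite Q] : Finite (Node Q) := by
  refine Finite.of_surjective (fun x : Set Q ⊕ Q ⊕ Q => match x with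
    | .inl s => Node.vert s
    | .inr (.inl q) => .inn q
    | .inr (.inr q) => .out q) ?_
  rintro (s | q | q)
  exacts [⟨.inl s, rfl⟩, ⟨.inr (.inl q), rfl⟩, ⟨.inr (.inr q), rfl⟩]

theorem card_set {Q : Type*} [Finite Q] : Nat.card (Set Q) = 2 ^ Nat.card Q := by
  have := Fintype.ofFinite Q
  rw [Nat.card_eq_fintype_card, Nat.card_eq_fintype_card, Fintype.card_set]

theorem card_node {Q : Type*} [Finite Q] :
    Nat.card (Node Q) = 2 ^ Nat.card Q + 2 * Nat.card Q := by
  have e : Node Q ≃ Set Q ⊕ Q ⊕ Q :=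
    { toFun := fun n => match n with
        | .vert s => .inl s
        | .inn q => .inr (.inl q)
        | .out q => .inr (.inr q)
      invFun := fun x => match x with
        | .inl s => .vert s
        | .inr (.inl q) => .inn q
        | .inr (.inr q) => .out q
      left_inv := by rintro (s | q | q) <;> rfl
      right_inv := by rintro (s | q | q) <;> rfl }
  rw [Nat.card_congr e, Nat.card_sum, Nat.card_sum, card_set]
  omega

theorem exists_reach_of_mem_vertices {α Q : Type*} {f : α → Option α} {e o : Q → α}
    {t : Set Q} (ht : t ∈ (reduct f e o).vertices) {q : Q} (hq : q ∈ t) :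
    ∃ p, Reach f (e q) (o p) := by
  obtain ⟨-, s, p, rfl, h⟩ := ht
  exact ⟨p, Relation.ReflTransGen.trans hq h⟩

theorem exists_exit_of_mem_vertices {α Q : Type*} {f : α → Option α} {e o : Q → α}
    (ho : IsExit f o) {s : α} (ht : entries f e s ∈ (reduct f e o).vertices) :
    ∃ p, Reach f s (o p) := by
  obtain ⟨q, hq⟩ := ht.1
  obtain ⟨p, hp⟩ := exists_reach_of_mem_vertices ht hq
  exact ⟨p, ho.reach hp hq⟩

namespace Transducer

variable {A B Q : Type*} {T : Transducer A B Q}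

/-! ## The labels of the vertices -/

section VertexLabel

variable {G : MergeForest Q} {a : EndMarked A} {l : Set Q → T.Var} {s t : Set Q} {q : Q}
  {x : T.Var}

theorem pathFrom_next {n : Node Q} {k : List (Node Q)} (h : Trace (T.next G a) n k) :
    pathFrom (T.next G a) T.fuel n = k := by
  have := T.finite_states
  exact h.pathFrom_eq (h.length_le.trans_eq card_node)

-- Frees the label from the fuel and from the chosen element of `t`: the path may start at any
-- element.
open Classical in
theorem vertexLabel_eq (ht : t ∈ (T.extend G a).vertices) (hq : q ∈ t) {k : List (Node Q)}
    (hk : Trace (T.next G a) (.inn q) k) : T.vertexLabel G l a t =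
      (k.filter fun s => T.inSet G a s = t).flatMap (T.nodeLabel l a) := by
  have h : t.Nonempty := ⟨q, hq⟩
  obtain ⟨p, hp⟩ := exists_reach_of_mem_vertices (e := Node.inn) (o := Node.out) ht h.some_mem
  obtain ⟨k', hk'⟩ := (isExit_next G a).exists_trace hp
  rw [vertexLabel, dif_pos h, pathFrom_next hk']
  congr 1
  exact hk'.filter_entries_eq hk h.some_mem hq

/-- A set that is not a vertex of `G` is a node without outgoing edge, so it is on no path to an
exit. -/
theorem exists_trace_of_mem_vertices (ht : t ∈ (T.extend G a).vertices) (hq : q ∈ t) :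
    ∃ k, Trace (T.next G a) (.inn q) k ∧ ∀ s, .vert s ∈ k → s ∈ G.vertices := by
  obtain ⟨p, hp⟩ := exists_reach_of_mem_vertices (e := Node.inn) (o := Node.out) ht hq
  obtain ⟨k, hk⟩ := (isExit_next G a).exists_trace hp
  refine ⟨k, hk, fun s hs => ?_⟩
  rw [hk.mem_iff] at hs
  by_contra hn
  have := Reach.eq_of_none (f := T.next G a) (x := .vert s) (by simp [next, hn])
    ((isExit_next G a).reach hp hs)
  cases this

theorem inr_notMem_nodeLabel_inn : Sum.inr x ∉ T.nodeLabel l a (.inn q) := by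
  unfold nodeLabel
  simp only
  split <;> simp

theorem exists_of_mem_vertexLabel (ht : t ∈ (T.extend G a).vertices)
    (h : Sum.inr x ∈ T.vertexLabel G l a t) :
    ∃ s ∈ G.vertices, l s = x ∧ T.inSet G a (.vert s) = t := by
  classical
  obtain ⟨q, hq⟩ := ht.1
  obtain ⟨k, hk, hv⟩ := exists_trace_of_mem_vertices ht hq
  rw [vertexLabel_eq ht hq hk, List.mem_flatMap] at h
  obtain ⟨n, h1, h2⟩ := h
  simp only [List.mem_filter, decide_eq_true_eq] at h1
  cases n with
  | vert s =>
    simp only [nodeLabel, List.mem_singleton, Sum.inr.injEq] at h2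
    exact ⟨s, hv s h1.1, h2.symm, h1.2⟩
  | inn q => exact absurd h2 inr_notMem_nodeLabel_inn
  | out q => simp [nodeLabel] at h2

-- A path to an exit repeats no node, only vertices carry variables, and `l` is injective on them.
-- So the variable of `s` flows to at most one vertex, and once; this is copylessness.
open Classical in
theorem occ_vertexLabel (hl : Set.InjOn l G.vertices) (ht : t ∈ (T.extend G a).vertices)
    (hs : s ∈ G.vertices) :
    occ (l s) (T.vertexLabel G l a t) = if T.inSet G a (.vert s) = t then 1 else 0 := by
  obtain ⟨q, hq⟩ := ht.1
  obtain ⟨k, hk, hv⟩ := exists_trace_of_mem_vertices ht hq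
  rw [vertexLabel_eq ht hq hk, occ_flatMap (hk.nodup.filter _) (.vert s)]
  · congr 1
    simp only [List.mem_filter, decide_eq_true_eq, eq_iff_iff, and_iff_right_iff_imp, hk.mem_iff]
    rintro rfl
    exact hq
  · intro m hm
    rw [List.mem_filter] at hm
    cases m with
    | vert s' =>
      simp only [nodeLabel, occ_var, Node.vert.injEq]
      congr 1
      exact propext (hl.eq_iff (hv s' hm.1) hs)
    | inn q => simp [occ_eq_zero inr_notMem_nodeLabel_inn]
    | out q => simp [nodeLabel, occ_nil]

end VertexLabel

/-! ## Updates -/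

section Update

variable {lab : T.SSTState → Set Q → T.Var} {G : T.SSTState} {a : A} {t : Set Q} {x y : T.Var}

theorem update_lab (hlab : T.IsLabeling lab) (ht : t ∈ (T.succ G a).1.vertices) :
    T.update lab G a (lab (T.succ G a) t) = T.vertexLabel G.1 (lab G) (.letter a) t := by
  have h : ∃ t' ∈ (T.succ G a).1.vertices, lab (T.succ G a) t' = lab (T.succ G a) t := ⟨t, ht, rfl⟩
  rw [update, dif_pos h]
  congr 1
  exact hlab _ h.choose_spec.1 ht h.choose_spec.2

theorem update_eq_nil (h : ∀ t ∈ (T.succ G a).1.vertices, lab (T.succ G a) t ≠ y) :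
    T.update lab G a y = [] := by
  rw [update, dif_neg]
  rintro ⟨t, h1, h2⟩
  exact h t h1 h2

theorem exists_of_mem_update (hlab : T.IsLabeling lab) (h : Sum.inr x ∈ T.update lab G a y) :
    ∃ s ∈ G.1.vertices, lab G s = x ∧
      lab (T.succ G a) (T.inSet G.1 (.letter a) (.vert s)) = y := by
  by_cases hy : ∃ t ∈ (T.succ G a).1.vertices, lab (T.succ G a) t = y
  · obtain ⟨t, ht, rfl⟩ := hy
    rw [update_lab hlab ht] at h
    obtain ⟨s, h1, h2, rfl⟩ := exists_of_mem_vertexLabel ht h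
    exact ⟨s, h1, h2, rfl⟩
  · rw [update_eq_nil fun t ht e => hy ⟨t, ht, e⟩] at h
    simp at h

theorem occ_update_eq_zero (hlab : T.IsLabeling lab) (h : ∀ s ∈ G.1.vertices, lab G s ≠ x) :
    occ x (T.update lab G a y) = 0 := by
  refine occ_eq_zero fun h' => ?_
  obtain ⟨s, h1, h2, -⟩ := exists_of_mem_update hlab h'
  exact h s h1 h2

theorem copyless_update (hlab : T.IsLabeling lab) : SST.CopylessSubst (T.update lab G a) := by
  classical
  constructor
  · intro x y z hy hz
    obtain ⟨s, h1, h2, rfl⟩ := exists_of_mem_update hlab hy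
    obtain ⟨s', h3, h4, rfl⟩ := exists_of_mem_update hlab hz
    rw [hlab G h1 h3 (h2.trans h4.symm)]
  · intro x y
    by_cases hx : ∃ s ∈ G.1.vertices, lab G s = x
    · by_cases hy : ∃ t ∈ (T.succ G a).1.vertices, lab (T.succ G a) t = y
      · obtain ⟨s, hs, rfl⟩ := hx
        obtain ⟨t, ht, rfl⟩ := hy
        rw [update_lab hlab ht, occ_vertexLabel (hlab G) ht hs]
        split_ifs <;> simp
      · rw [update_eq_nil fun t ht e => hy ⟨t, ht, e⟩, occ_nil]
        simp
    · rw [occ_update_eq_zero hlab fun s hs e => hx ⟨s, hs, e⟩]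
      simp

theorem copyless_toSST (hlab : T.IsLabeling lab) : (T.toSST lab).Copyless := by
  intro p a q σ h
  simp only [toSST, Option.some.injEq, Prod.mk.injEq] at h
  obtain ⟨-, rfl⟩ := h
  exact copyless_update hlab

end Update

/-! ## Runs of the streaming string transducer -/

section Run

variable (T)

/-- The state reached from `G` by reading a word. -/
noncomputable def read (G : T.SSTState) (u : List A) : T.SSTState := u.foldl T.succ G

/-- The substitution induced by a run. -/
noncomputable def runSubst (lab : T.SSTState → Set Q → T.Var) :
    T.SSTState → List A → Subst B T.Var
  | _, [] => fun x => [Sum.inr x]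
  | G, a :: u => (T.update lab G a).comp (runSubst lab (T.succ G a) u)

variable {T} {lab : T.SSTState → Set Q → T.Var} {G : T.SSTState}

theorem run_toSST (u : List A) :
    (T.toSST lab).run G u = some (T.read G u, T.runSubst lab G u) := by
  induction u generalizing G with
  | nil => rfl
  | cons a u ih =>
    simp only [SST.run]
    rw [show (T.toSST lab).δ G a = some (T.succ G a, T.update lab G a) from rfl]
    simp only [ih]
    rfl

theorem read_val {w : List A} (h : G.1 = T.forest w) (u : List A) :
    (T.read G u).1 = T.forest (w ++ u) := by
  induction u generalizing G w with
  | nil => simpa [read] using h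
  | cons a u ih =>
    have : (T.succ G a).1 = T.forest (w ++ [a]) := by
      simp [succ, h, forest]
    simpa [read] using ih this

theorem subst_comp_id {X : Type*} (σ : Subst B X) : σ.comp (fun x => [Sum.inr x]) = σ := by
  funext x
  simp [Subst.comp, Subst.apply]

theorem subst_id_comp {X : Type*} (σ : Subst B X) : Subst.comp (fun x => [Sum.inr x]) σ = σ := by
  funext y
  simp only [Subst.comp, Subst.apply]
  conv_rhs => rw [← List.flatMap_singleton' (σ y)]
  congr 1
  funext z
  cases z <;> rfl

theorem read_append (u v : List A) : T.read G (u ++ v) = T.read (T.read G u) v := by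
  simp [read]

theorem runSubst_snoc (u : List A) (a : A) : T.runSubst lab G (u ++ [a]) =
    (T.runSubst lab G u).comp (T.update lab (T.read G u) a) := by
  induction u generalizing G with
  | nil =>
    simp only [List.nil_append, runSubst, subst_comp_id, subst_id_comp]
    rfl
  | cons b u ih =>
    simp only [List.cons_append, runSubst, ih, SST.comp_assoc]
    rfl

/-- Nonemptiness matters: the empty word induces the identity, under which variables that label no
vertex survive. -/
theorem occ_runSubst_eq_zero_left (hlab : T.IsLabeling lab) {u : List A} (hu : u ≠ []) {x y : T.Var}
    (h : ∀ s ∈ G.1.vertices, lab G s ≠ x) : occ x (T.runSubst lab G u y) = 0 := by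
  cases u with
  | nil => exact absurd rfl hu
  | cons a u =>
    simp only [runSubst, Subst.comp, SST.occ_apply]
    exact Finset.sum_eq_zero fun z _ => by rw [occ_update_eq_zero hlab h, mul_zero]

theorem occ_runSubst_eq_zero_right {u : List A} (hu : u ≠ []) {x y : T.Var}
    (h : ∀ t ∈ (T.read G u).1.vertices, lab (T.read G u) t ≠ y) :
    occ x (T.runSubst lab G u y) = 0 := by
  rcases List.eq_nil_or_concat u with rfl | ⟨u, a, rfl⟩
  · exact absurd rfl hu
  · rw [List.concat_eq_append] at h ⊢
    rw [runSubst_snoc, Subst.comp, update_eq_nil]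
    · exact occ_nil x
    · rw [read_append] at h
      exact h

/-- Membership in the sets of entries in the extension of a forest, in terms of
configurations. -/
theorem inSet_vert_eq_iff {x : List (EndMarked A)} {a : EndMarked A} {c : Conf Q} {p : Q}
    (hc : Reach (T.cstep x) c (.ex p x.length)) (hpos : c.pos ≤ x.length)
    (hne : (T.confEntries x c).Nonempty) {t : Set Q} (ht : t ∈ (T.runForest (x ++ [a])).vertices) :
    T.inSet (T.runForest x) a (.vert (T.confEntries x c)) = t ↔
      T.confEntries (x ++ [a]) c = t := by
  have S := isSimulation_corr T x a
  have hcorr : T.Corr x c (.vert (T.confEntries x c)) := ⟨hpos, rfl, hne, p, hc⟩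
  constructor
  · rintro rfl
    rw [← extend_runForest] at ht
    obtain ⟨r, hr⟩ := exists_exit_of_mem_vertices (e := Node.inn) (isExit_next _ a) ht
    exact (S.entries_iff hcorr ((S.reach_exit_iff hcorr r).2 hr)).symm
  · rintro rfl
    obtain ⟨r, hr⟩ := exists_exit_of_mem_vertices (isExit_cstep T _) ht
    exact S.entries_iff hcorr hr

theorem pos_le_of_reach_exit {x : List (EndMarked A)} {c : Conf Q} {p : Q}
    (h : Reach (T.cstep x) c (.ex p x.length)) : c.pos ≤ x.length := by
  rcases Relation.ReflTransGen.cases_head h with rfl | ⟨d, hd, -⟩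
  · exact le_rfl
  · exact (cstep_pos hd).1

open Classical in
/-- The flow from a variable to a variable. -/
theorem occ_runSubst (hlab : T.IsLabeling lab) {w : List A} (hG : G.1 = T.forest w) {c : Conf Q}
    {p : Q} (hc : Reach (T.cstep (leftMarked w)) c (.ex p (leftMarked w).length))
    (hne : (T.confEntries (leftMarked w) c).Nonempty) (u : List A) {t : Set Q}
    (ht : t ∈ (T.read G u).1.vertices) :
    occ (lab G (T.confEntries (leftMarked w) c)) (T.runSubst lab G u (lab (T.read G u) t)) =
      if T.confEntries (leftMarked (w ++ u)) c = t then 1 else 0 := by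
  have hpos := pos_le_of_reach_exit hc
  induction u using List.reverseRecOn generalizing t with
  | nil =>
    have hs : T.confEntries (leftMarked w) c ∈ G.1.vertices := by
      rw [hG, forest_eq]
      obtain ⟨q, hq⟩ := hne
      exact entries_mem_vertices hq hc
    simp only [runSubst, occ_var, List.append_nil]
    congr 1
    rw [eq_comm (a := T.confEntries _ _)]
    exact propext ((hlab G).eq_iff ht hs)
  | append_singleton u a ih =>
    have hG' := read_val hG u
    have hm : leftMarked (w ++ (u ++ [a])) = leftMarked (w ++ u) ++ [.letter a] := by
      rw [← List.append_assoc, leftMarked_append (w ++ u)]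
      rfl
    rw [runSubst_snoc, Subst.comp, SST.occ_apply]
    rw [read_append] at ht ⊢
    have ht' : t ∈ (T.runForest (leftMarked (w ++ u) ++ [.letter a])).vertices := by
      have h1 := read_val hG (u ++ [a])
      rw [read_append, forest_eq, hm] at h1
      rwa [h1] at ht
    have hle : c.pos ≤ (leftMarked (w ++ u)).length := by
      rw [leftMarked_append, List.length_append]
      omega
    replace ht : t ∈ (T.succ (T.read G u) a).1.vertices := ht
    rw [show T.read (T.read G u) [a] = T.succ (T.read G u) a from rfl, update_lab hlab ht, hm]
    have hterm : ∀ s ∈ (T.read G u).1.vertices,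
        occ (lab (T.read G u) s) (T.vertexLabel (T.read G u).1 (lab (T.read G u)) (.letter a) t) *
          occ (lab G (T.confEntries (leftMarked w) c))
            (T.runSubst lab G u (lab (T.read G u) s)) =
          (if T.inSet (T.read G u).1 (.letter a) (.vert s) = t then 1 else 0) *
            if T.confEntries (leftMarked (w ++ u)) c = s then 1 else 0 := by
      intro s hs
      rw [ih hs, occ_vertexLabel (hlab _) ht hs]
    have hterm' : ∀ z, (∀ s ∈ (T.read G u).1.vertices, lab (T.read G u) s ≠ z) →
        occ z (T.vertexLabel (T.read G u).1 (lab (T.read G u)) (.letter a) t) = 0 := by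
      intro z hz
      refine occ_eq_zero fun h => ?_
      obtain ⟨s, h1, h2, -⟩ := exists_of_mem_vertexLabel ht h
      exact hz s h1 h2
    -- Among the intermediate variables only that of the vertex of `c` over `⊢ w u` can contribute.
    -- If there is no such vertex, then `t` is not the set of `c` over `⊢ w u a` either: a run from
    -- `c` that leaves `⊢ w u a` first leaves `⊢ w u`.
    by_cases h0 : T.confEntries (leftMarked (w ++ u)) c ∈ (T.read G u).1.vertices
    · rw [Finset.sum_eq_single (lab (T.read G u) (T.confEntries (leftMarked (w ++ u)) c)),
        hterm _ h0, if_pos rfl, mul_one]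
      · congr 1
        rw [hG', forest_eq] at h0 ⊢
        obtain ⟨r, hr⟩ := exists_exit_of_mem_vertices (isExit_cstep T _) h0
        exact propext (inSet_vert_eq_iff hr hle h0.1 ht')
      · intro z _ hz
        by_cases hz' : ∃ s ∈ (T.read G u).1.vertices, lab (T.read G u) s = z
        · obtain ⟨s, hs, rfl⟩ := hz'
          rw [hterm s hs, if_neg (c := _ = s), mul_zero]
          rintro rfl
          exact hz rfl
        · rw [hterm' z fun s hs e => hz' ⟨s, hs, e⟩, zero_mul]
      · simp
    · rw [if_neg]
      · refine Finset.sum_eq_zero fun z _ => ?_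
        by_cases hz' : ∃ s ∈ (T.read G u).1.vertices, lab (T.read G u) s = z
        · obtain ⟨s, hs, rfl⟩ := hz'
          rw [hterm s hs, if_neg (c := _ = s), mul_zero]
          rintro rfl
          exact h0 hs
        · rw [hterm' z fun s hs e => hz' ⟨s, hs, e⟩, zero_mul]
      · rintro rfl
        apply h0
        rw [hG', forest_eq]
        obtain ⟨r, hr⟩ := exists_exit_of_mem_vertices (isExit_cstep T _) ht'
        obtain ⟨r', hr', -⟩ := reach_leave hr hle (by simp [Conf.pos])
        obtain ⟨q, hq⟩ := ht'.1
        rw [confEntries_append hle] at hq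
        obtain ⟨q', hq', -⟩ := hq
        exact entries_mem_vertices hq' hr'

/-- Each vertex of the state at `w` is the set of some configuration `c` on `⊢ w`, so `occ_runSubst`
expresses its flow by the set of `c` over the longer word. Variables that label no vertex have no
flow, because both words are nonempty. -/
theorem flow_toSST_eq (hlab : T.IsLabeling lab) {u u' : List A} (hu : u ≠ []) (hu' : u' ≠ [])
    (hf : ∀ w, T.forest (w ++ u) = T.forest (w ++ u'))
    (he : ∀ w c, c.pos ≤ (leftMarked w).length →
      T.confEntries (leftMarked (w ++ u)) c = T.confEntries (leftMarked (w ++ u')) c) :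
    (T.toSST lab).flow u = (T.toSST lab).flow u' := by
  classical
  funext ⟨G, x⟩ ⟨G', y⟩
  obtain ⟨w, hG⟩ := G.2
  have hr : T.read G u = T.read G u' := Subtype.ext <| by
    rw [read_val hG, read_val hG, hf]
  simp only [SST.flow, run_toSST, hr]
  suffices h : occ x (T.runSubst lab G u y) = occ x (T.runSubst lab G u' y) by rw [h]
  by_cases hx : ∃ s ∈ G.1.vertices, lab G s = x
  · by_cases hy : ∃ t ∈ (T.read G u).1.vertices, lab (T.read G u) t = y
    · obtain ⟨s, hs, rfl⟩ := hx
      obtain ⟨t, ht, rfl⟩ := hy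
      rw [hG, forest_eq] at hs
      obtain ⟨hne, c, p, rfl, hc⟩ := hs
      rw [occ_runSubst hlab hG hc hne u ht, hr, occ_runSubst hlab hG hc hne u' (hr ▸ ht),
        he w c (pos_le_of_reach_exit hc)]
    · have hy' : ∀ t ∈ (T.read G u).1.vertices, lab (T.read G u) t ≠ y :=
        fun t ht e => hy ⟨t, ht, e⟩
      rw [occ_runSubst_eq_zero_right hu hy', occ_runSubst_eq_zero_right hu']
      rwa [← hr]
  · have hx' : ∀ s ∈ G.1.vertices, lab G s ≠ x := fun s hs e => hx ⟨s, hs, e⟩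
    rw [occ_runSubst_eq_zero_left hlab hu hx', occ_runSubst_eq_zero_left hlab hu' hx']

end Run

end Transducer
/-! ## Replacement of factors with the same behaviors -/

/-- The configuration in which a word of length `n` is entered from a side. -/
def Side.confIn {Q : Type*} : Side → ℕ → Q → Conf Q
  | .left, _, q => .rd q 1
  | .right, n, q => .rd q n

/-- The configuration in which a word of length `n` is exited on a side. -/
def Side.confOut {Q : Type*} : Side → ℕ → Q → Conf Q
  | .left, _, q => .rd q 0
  | .right, n, q => .ex q n

/-- The configurations outside of a factor, preceded by `k` cells, and their counterparts
when this factor, of length `m`, is replaced by one of length `m'`. -/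
inductive Outside {Q : Type*} (k m m' : ℕ) : Conf Q → Conf Q → Prop
  | left (c : Conf Q) (h : c.pos ≤ k) : Outside k m m' c c
  | rd (q : Q) (i : ℕ) (h : 1 ≤ i) : Outside k m m' (.rd q (k + (m + i))) (.rd q (k + (m' + i)))
  | ex (q : Q) (i : ℕ) : Outside k m m' (.ex q (k + (m + i))) (.ex q (k + (m' + i)))

theorem Outside.symm {Q : Type*} {k m m' : ℕ} {c c' : Conf Q} (h : Outside k m m' c c') :
    Outside k m' m c' c := by
  cases h with
  | left _ h => exact .left _ h
  | rd q i h => exact .rd q i h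
  | ex q i => exact .ex q i

/-- For `m = 0` the configuration `ex q k` would count as being on the left of the factor and on its
right. -/
theorem Outside.functional {Q : Type*} {k m m' : ℕ} (hm : 1 ≤ m) {c c' c'' : Conf Q}
    (h : Outside k m m' c c') (h' : Outside k m m' c c'') : c' = c'' := by
  cases h with
  | left _ h =>
    generalize hd : c = d at h'
    cases h' with
    | left => rfl
    | rd q i => subst hd; simp only [Conf.pos] at h; omega
    | ex q i => subst hd; simp only [Conf.pos] at h; omega
  | rd q i h =>
    generalize hd : Conf.rd q (k + (m + i)) = d at h'
    cases h' with
    | left _ h' => subst hd; simp only [Conf.pos] at h'; omega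
    | rd q' i' => simp only [Conf.rd.injEq] at hd ⊢; exact ⟨hd.1, by omega⟩
    | ex q i => cases hd
  | ex q i =>
    generalize hd : Conf.ex q (k + (m + i)) = d at h'
    cases h' with
    | left _ h' => subst hd; simp only [Conf.pos] at h'; omega
    | rd q' i' => cases hd
    | ex q i => simp only [Conf.ex.injEq] at hd ⊢; exact ⟨hd.1, by omega⟩

/-- The configurations inside a word of length `m`. -/
def Conf.Inside {Q : Type*} (m : ℕ) : Conf Q → Prop
  | .rd _ i => 1 ≤ i ∧ i ≤ m
  | .ex _ i => 1 ≤ i ∧ i < m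

theorem Conf.Inside.not_outside {Q : Type*} {k m m' : ℕ} {c d : Conf Q} (h : c.Inside m) :
    ¬ Outside k m m' (c.shift k) d := by
  intro h'
  generalize hd : c.shift k = c' at h'
  cases c <;> cases h' <;> simp_all [Conf.Inside, Conf.shift] <;> subst_vars <;>
    simp_all [Conf.pos]

namespace Transducer

variable {A B Q : Type*} {T : Transducer A B Q}

variable (T) in
/-- The words `v` and `v'` are nonempty, and what holds for the behaviors of `v` holds for
those of `v'`. -/
structure BehLE (v v' : List (EndMarked A)) : Prop where
  pos : 1 ≤ v.length
  pos' : 1 ≤ v'.length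
  imp : ∀ (x y : Side) (p q : Q), Reach (T.cstep v) (x.confIn v.length p) (y.confOut v.length q) →
    Reach (T.cstep v') (x.confIn v'.length p) (y.confOut v'.length q)

theorem cstep_inside {y v z : List (EndMarked A)} {c d : Conf Q} (hc : c.Inside v.length)
    (h : T.cstep (y ++ (v ++ z)) (c.shift y.length) = some d) :
    ∃ d', T.cstep v c = some d' ∧ d = d'.shift y.length ∧
      (d'.Inside v.length ∨ ∃ x q, d' = Side.confOut x v.length q) := by
  cases c with
  | rd p i =>
    obtain ⟨h1, h2⟩ := hc
    obtain ⟨a, w, q, m, h3, h4, rfl⟩ := cstep_rd_iff.1 h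
    rw [cell_append_right _ _ h1, cell_append_left _ h2] at h3
    refine ⟨m.conf q i, cstep_rd_iff.2 ⟨a, w, q, m, h3, h4, rfl⟩, ?_, ?_⟩
    · cases m <;> simp only [Move.conf, Conf.shift, Conf.rd.injEq, true_and]
      omega
    · cases m with
      | left =>
        by_cases hi : i = 1
        · subst hi
          exact .inr ⟨.left, q, rfl⟩
        · exact .inl ⟨by omega, by omega⟩
      | stay => exact .inl ⟨h1, h2⟩
      | right =>
        by_cases hi : i = v.length
        · subst hi
          exact .inr ⟨.right, q, rfl⟩
        · exact .inl ⟨by omega, by omega⟩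
  | ex p i =>
    obtain ⟨h1, h2⟩ := hc
    obtain ⟨-, rfl⟩ := cstep_ex_iff.1 h
    exact ⟨_, cstep_ex h2, rfl, .inl ⟨by omega, by omega⟩⟩

/-- The run is cut into steps outside of the factor, which are copied, and excursions into the
factor, each of which is exchanged for one with the same ends. The second conjunct is the invariant
during an excursion: it has to end, as `d` is outside, and the rest of the run can be copied from
its exit on. -/
theorem reach_replace {y v v' z : List (EndMarked A)} (hv : T.BehLE v v') {c d d' : Conf Q}
    (hd : Outside y.length v.length v'.length d d') (h : Reach (T.cstep (y ++ (v ++ z))) c d) :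
    (∀ c', Outside y.length v.length v'.length c c' → Reach (T.cstep (y ++ (v' ++ z))) c' d') ∧
    ∀ c', c'.Inside v.length → c = c'.shift y.length → ∃ x q,
      Reach (T.cstep v) c' (Side.confOut x v.length q) ∧
      Reach (T.cstep (y ++ (v' ++ z))) ((x.confOut v'.length q).shift y.length) d' := by
  have hpos := hv.pos
  induction h using Relation.ReflTransGen.head_induction_on with
  | refl =>
    refine ⟨fun c' hc => by rw [hc.functional hpos hd], fun c' hc e => ?_⟩
    subst e
    exact absurd hd hc.not_outside
  | @head c c₁ h1 _ ih =>
    -- an excursion through the factor, which is entered from the side `x`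
    have enter : ∀ (x : Side) (p : Q), c₁ = (x.confIn v.length p).shift y.length →
        Reach (T.cstep (y ++ (v' ++ z))) ((x.confIn v'.length p).shift y.length) d' := by
      intro x p e
      obtain ⟨x', q, h2, h3⟩ := ih.2 (x.confIn v.length p)
        (by cases x <;> exact ⟨by omega, by omega⟩) e
      exact (reach_shift y v' z (hv.imp _ _ _ _ h2)).trans h3
    constructor
    · intro c' hc
      cases hc with
      | left _ hc =>
        rcases cstep_of_append h1 hc with h2 | ⟨r, rfl, rfl⟩
        · exact .head (cstep_append _ h2) (ih.1 _ (.left _ (cstep_pos h2).2))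
        · refine .head (cstep_ex ?_) (enter .left r rfl)
          have := hv.pos'
          simp only [List.length_append]
          omega
      | rd p i hi =>
        obtain ⟨a, w, q, m, h3, h4, rfl⟩ := cstep_rd_iff.1 h1
        rw [cell_append_right _ _ (by omega), cell_append_right _ _ hi] at h3
        have h5 : T.cstep (y ++ (v' ++ z)) (.rd p (y.length + (v'.length + i))) =
            some (m.conf q (y.length + (v'.length + i))) := by
          refine cstep_rd_iff.2 ⟨a, w, q, m, ?_, h4, rfl⟩
          rw [cell_append_right _ _ (by omega), cell_append_right _ _ hi, h3]
        refine .head h5 ?_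
        cases m with
        | right => exact ih.1 _ (.ex q i)
        | stay => exact ih.1 _ (.rd q i hi)
        | left =>
          obtain ⟨i, rfl⟩ : ∃ j, i = j + 1 := ⟨i - 1, by omega⟩
          by_cases hi' : i = 0
          · subst hi'
            exact enter .right q rfl
          · exact ih.1 _ (.rd q i (by omega))
      | ex p i =>
        obtain ⟨h2, rfl⟩ := cstep_ex_iff.1 h1
        refine .head (cstep_ex ?_) (ih.1 _ (.rd p (i + 1) (by omega)))
        simp only [List.length_append] at h2 ⊢
        omega
    · rintro c' hc' rfl
      obtain ⟨d₁, h2, rfl, (h3 | ⟨x, q, rfl⟩)⟩ := cstep_inside hc' h1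
      · obtain ⟨x, q, h4, h5⟩ := ih.2 _ h3 rfl
        exact ⟨x, q, .head h2 h4, h5⟩
      · refine ⟨x, q, .single h2, ih.1 _ ?_⟩
        cases x with
        | left => exact .left _ (by simp [Side.confOut, Conf.shift, Conf.pos])
        | right => exact .ex q 0

theorem reach_replace_outside {y v v' z : List (EndMarked A)} (hv : T.BehLE v v')
    {c c' d d' : Conf Q} (hc : Outside y.length v.length v'.length c c')
    (hd : Outside y.length v.length v'.length d d') (h : Reach (T.cstep (y ++ (v ++ z))) c d) :
    Reach (T.cstep (y ++ (v' ++ z))) c' d' :=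
  (reach_replace hv hd h).1 c' hc

theorem reach_replace_entry {y v v' z : List (EndMarked A)} (hv : T.BehLE v v')
    {q : Q} {d d' : Conf Q} (hd : Outside y.length v.length v'.length d d')
    (h : Reach (T.cstep (y ++ (v ++ z))) (.rd q (y ++ (v ++ z)).length) d) :
    Reach (T.cstep (y ++ (v' ++ z))) (.rd q (y ++ (v' ++ z)).length) d' := by
  simp only [List.length_append] at h ⊢
  -- If nothing follows the factor, the entry lies inside of it and the run begins with an
  -- excursion.
  by_cases hz : z.length = 0
  · rw [hz] at h ⊢
    obtain ⟨x, r, h1, h2⟩ := (reach_replace hv hd h).2 (.rd q v.length) ⟨hv.pos, le_rfl⟩ rfl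
    exact (reach_shift y v' z (hv.imp .right x q r h1)).trans h2
  · exact reach_replace_outside hv (.rd q _ (by omega)) hd h

theorem confEntries_replace {y v v' z : List (EndMarked A)} (hv : T.BehLE v v')
    (hv' : T.BehLE v' v) {c c' : Conf Q} (hc : Outside y.length v.length v'.length c c') :
    T.confEntries (y ++ (v ++ z)) c = T.confEntries (y ++ (v' ++ z)) c' := by
  ext q
  exact ⟨reach_replace_entry hv hc, reach_replace_entry hv' hc.symm⟩

theorem reach_exit_replace {y v v' z : List (EndMarked A)} (hv : T.BehLE v v')
    {c c' : Conf Q} (hc : Outside y.length v.length v'.length c c') {p : Q}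
    (h : Reach (T.cstep (y ++ (v ++ z))) c (.ex p (y ++ (v ++ z)).length)) :
    Reach (T.cstep (y ++ (v' ++ z))) c' (.ex p (y ++ (v' ++ z)).length) := by
  simp only [List.length_append] at h ⊢
  exact reach_replace_outside hv hc (.ex p z.length) h

/-! ### Behaviors in terms of configurations -/

/-- A position beyond `|u|` means that the run has left `u` to the right; its counterpart is the
exit `ex`. -/
theorem reach_of_wordStep {u : List A} {c c' : Q × ℕ}
    (h : Relation.ReflTransGen (T.WordStep u) c c') :
    Reach (T.cstep (u.map .letter))
      (if c.2 ≤ u.length then .rd c.1 c.2 else .ex c.1 u.length)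
      (if c'.2 ≤ u.length then .rd c'.1 c'.2 else .ex c'.1 u.length) := by
  induction h with
  | refl => exact .refl
  | @tail b c _ h ih =>
    refine ih.trans ?_
    obtain ⟨v, a, m, h1, h2, h3⟩ := h
    have hb := wordCell_pos h1
    have h4 : T.exitδ b.1 a = some (v, c.1, m) := by
      rw [wordCell_eq] at h1
      have : ∃ a', a = .letter a' := by
        cases hb' : b.2 with
        | zero => omega
        | succ i =>
          rw [hb', cell, List.getElem?_map, Option.map_eq_some_iff] at h1
          obtain ⟨a', -, h⟩ := h1
          exact ⟨a', h.symm⟩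
      obtain ⟨a', rfl⟩ := this
      exact h2
    have h5 : T.cstep (u.map .letter) (.rd b.1 b.2) = some (m.conf c.1 b.2) :=
      cstep_rd_iff.2 ⟨a, v, c.1, m, by rwa [← wordCell_eq], h4, rfl⟩
    rw [if_pos hb.2]
    refine .head h5 ?_
    cases m with
    | left =>
      have h3 : b.2 = c.2 + 1 := h3
      rw [if_pos (by omega), h3]
      exact .refl
    | stay =>
      have h3 : c.2 = b.2 := h3
      rw [if_pos (by omega), h3]
      exact .refl
    | right =>
      have h3 : c.2 = b.2 + 1 := h3
      by_cases hc : c.2 ≤ u.length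
      · rw [if_pos hc, h3]
        exact .single (cstep_ex (by rw [List.length_map]; omega))
      · rw [if_neg hc, show u.length = b.2 by omega]
        exact .refl

/-- The state and the position of the next cell that is read. -/
def _root_.TwoWay.Conf.toPair : Conf Q → Q × ℕ
  | .rd q i => (q, i)
  | .ex q i => (q, i + 1)

theorem wordStep_of_reach {u : List A} {c c' : Conf Q}
    (h : Reach (T.cstep (u.map .letter)) c c') :
    Relation.ReflTransGen (T.WordStep u)
      c.toPair c'.toPair := by
  induction h with
  | refl => exact .refl
  | @tail b c _ h ih =>
    refine ih.trans ?_
    cases b with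
    | rd p i =>
      obtain ⟨a, v, q, m, h1, h2, rfl⟩ := cstep_rd_iff.1 h
      have hi := cell_pos h1
      have h4 : T.δ p a = some (v, q, m) := by
        have : ∃ a', a = .letter a' := by
          cases i with
          | zero => omega
          | succ i =>
            rw [cell, List.getElem?_map, Option.map_eq_some_iff] at h1
            obtain ⟨a', -, h⟩ := h1
            exact ⟨a', h.symm⟩
        obtain ⟨a', rfl⟩ := this
        exact h2
      rw [← wordCell_eq] at h1
      cases m with
      | left => exact .single ⟨v, a, .left, h1, h4, by
          simp only [Move.Moves, Move.conf, Conf.toPair]; omega⟩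
      | stay => exact .single ⟨v, a, .stay, h1, h4, rfl⟩
      | right => exact .single ⟨v, a, .right, h1, h4, rfl⟩
    | ex p i =>
      obtain ⟨-, rfl⟩ := cstep_ex_iff.1 h
      exact .refl

/-- This fails for the empty word, which is crossed without any step, whereas `rd p 1` and `ex p 0`
are different configurations. -/
theorem mem_beh_iff {u : List A} (hu : u ≠ []) (x y : Side) (p q : Q) :
    (p, q) ∈ T.beh x y u ↔ Reach (T.cstep (u.map .letter))
      (x.confIn (u.map EndMarked.letter).length p)
      (y.confOut (u.map EndMarked.letter).length q) := by
  have hpos := List.length_pos_of_ne_nil hu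
  rw [List.length_map]
  constructor
  · intro h
    have := reach_of_wordStep h
    cases x <;> cases y <;>
      simpa [Side.entry, Side.exit, Side.confIn, Side.confOut, Nat.succ_le_of_lt hpos] using this
  · intro h
    have := wordStep_of_reach h
    cases x <;> cases y <;> exact this

theorem behLE_of_beh_eq {u u' : List A} (hu : u ≠ []) (hu' : u' ≠ [])
    (h : ∀ x y, T.beh x y u = T.beh x y u') : T.BehLE (u.map .letter) (u'.map .letter) where
  pos := by rw [List.length_map]; exact List.length_pos_of_ne_nil hu
  pos' := by rw [List.length_map]; exact List.length_pos_of_ne_nil hu'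
  imp x y p q := by
    rw [← mem_beh_iff hu, ← mem_beh_iff hu', h]
    exact id

/-! ### Powers of words -/

/-- The `k`-th power of a word. -/
def wordPow (u : List A) (k : ℕ) : List A := ((FreeMonoid.ofList u) ^ k).toList

theorem wordPow_add (u : List A) (k m : ℕ) :
    wordPow u (k + m) = wordPow u k ++ wordPow u m := by
  simp [wordPow, pow_add]

theorem wordPow_one (u : List A) : wordPow u 1 = u := by
  simp [wordPow]

theorem wordPow_ne_nil {u : List A} (hu : u ≠ []) (k : ℕ) : wordPow u (k + 1) ≠ [] := by
  rw [wordPow_add, wordPow_one]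
  simp [hu]

theorem con_coe_pow {M : Type*} [Monoid M] (c : Con M) (x : M) (k : ℕ) :
    ((x ^ k : M) : c.Quotient) = (x : c.Quotient) ^ k := rfl

theorem beh_wordPow {n : ℕ} (h : ∀ x : T.TransitionMonoid, x ^ n = x ^ (n + 1)) (u : List A)
    (k : ℕ) (x y : Side) : T.beh x y (wordPow u (n + k)) = T.beh x y (wordPow u (n + k + 1)) := by
  have h1 : ((FreeMonoid.ofList u : FreeMonoid A) : T.TransitionMonoid) ^ (n + k) =
      ((FreeMonoid.ofList u : FreeMonoid A) : T.TransitionMonoid) ^ (n + k + 1) := by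
    rw [pow_add, h, ← pow_add]
    congr 1
    omega
  rw [← con_coe_pow, ← con_coe_pow, Con.eq] at h1
  exact h1 x y

theorem Aperiodic.exists_behLE (hT : T.Aperiodic) : ∃ n, 1 ≤ n ∧ ∀ u : List A, u ≠ [] →
    ∀ k, T.BehLE ((wordPow u (n + k)).map .letter) ((wordPow u (n + k + 1)).map .letter) ∧
      T.BehLE ((wordPow u (n + k + 1)).map .letter) ((wordPow u (n + k)).map .letter) := by
  obtain ⟨n, hn⟩ := hT
  -- The exponent is raised by one so that all powers considered are nonempty.
  refine ⟨n + 1, by omega, fun u hu k => ?_⟩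
  have h1 : wordPow u (n + 1 + k) ≠ [] := by
    rw [show n + 1 + k = n + k + 1 by omega]
    exact wordPow_ne_nil hu _
  have h2 := wordPow_ne_nil hu (n + 1 + k)
  have h3 := beh_wordPow hn u (1 + k)
  rw [← Nat.add_assoc] at h3
  exact ⟨behLE_of_beh_eq h1 h2 h3, behLE_of_beh_eq h2 h1 fun x y => (h3 x y).symm⟩

/-! ### Forests under replacement of factors, and aperiodicity of the streaming string transducer -/

/-- Forests only depend on the sets of entries and the exits of the configurations. -/
theorem runForest_congr {x y : List (EndMarked A)}
    (h : ∀ c : Conf Q, c.pos ≤ x.length → ∃ c', T.confEntries x c = T.confEntries y c' ∧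
      ∀ p, Reach (T.cstep x) c (.ex p x.length) → Reach (T.cstep y) c' (.ex p y.length))
    (h' : ∀ c : Conf Q, c.pos ≤ y.length → ∃ c', T.confEntries y c = T.confEntries x c' ∧
      ∀ p, Reach (T.cstep y) c (.ex p y.length) → Reach (T.cstep x) c' (.ex p x.length)) :
    T.runForest x = T.runForest y := by
  have key : ∀ (t : Set Q) p, (∃ s, t.Nonempty ∧ T.confEntries x s = t ∧
        Reach (T.cstep x) s (.ex p x.length)) ↔
      ∃ s, t.Nonempty ∧ T.confEntries y s = t ∧ Reach (T.cstep y) s (.ex p y.length) := by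
    intro t p
    constructor
    · rintro ⟨c, h1, rfl, h2⟩
      obtain ⟨c', h3, h4⟩ := h c (pos_le_of_reach_exit h2)
      exact ⟨c', h1, h3.symm, h4 p h2⟩
    · rintro ⟨c, h1, rfl, h2⟩
      obtain ⟨c', h3, h4⟩ := h' c (pos_le_of_reach_exit h2)
      exact ⟨c', h1, h3.symm, h4 p h2⟩
  unfold runForest reduct
  congr 1
  · ext t
    constructor
    · rintro ⟨h, s, p, h1, h2⟩
      obtain ⟨c, h3, h4, h5⟩ := (key t p).1 ⟨s, h, h1, h2⟩
      exact ⟨h, c, p, h4, h5⟩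
    · rintro ⟨h, s, p, h1, h2⟩
      obtain ⟨c, h3, h4, h5⟩ := (key t p).2 ⟨s, h, h1, h2⟩
      exact ⟨h, c, p, h4, h5⟩
  · funext t
    exact dite_choose_congr (funext fun p => propext (key t p))

theorem Outside.of_lt {k m m' : ℕ} {c : Conf Q} (h : k + m < c.pos) :
    ∃ c', Outside k m m' c c' := by
  cases c with
  | rd q i =>
    simp only [Conf.pos] at h
    obtain ⟨j, rfl⟩ : ∃ j, i = k + (m + j) := ⟨i - (k + m), by omega⟩
    exact ⟨_, .rd q j (by omega)⟩
  | ex q i =>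
    simp only [Conf.pos] at h
    obtain ⟨j, rfl⟩ : ∃ j, i = k + (m + j) := ⟨i - (k + m), by omega⟩
    exact ⟨_, .ex q j⟩

theorem runForest_replace {y z : List (EndMarked A)} {v v' : List (EndMarked A)}
    (h : T.BehLE v v') (h' : T.BehLE v' v) {x x' : List (EndMarked A)}
    (hx : x = y ++ (v ++ z)) (hx' : x' = y ++ (v' ++ z)) {c c' : Conf Q}
    (hc : Outside y.length v.length v'.length c c') :
    T.confEntries x c = T.confEntries x' c' ∧
      ∀ p, Reach (T.cstep x) c (.ex p x.length) → Reach (T.cstep x') c' (.ex p x'.length) := by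
  subst hx
  subst hx'
  exact ⟨confEntries_replace h h' hc, fun p => reach_exit_replace h hc⟩

theorem Aperiodic.toSST (hT : T.Aperiodic) {lab : T.SSTState → Set Q → T.Var}
    (hlab : T.IsLabeling lab) : (T.toSST lab).Aperiodic := by
  obtain ⟨n, hn, hbeh⟩ := hT.exists_behLE
  -- Forests involve the configurations inside the power too, but replacement controls only those
  -- outside of the replaced factor. The exponent leaves room for a factor `u ^ n` at either end of
  -- the power, so that one of the two avoids the configuration.
  refine ⟨n + (n + 1), fun x => ?_⟩
  induction x using Con.induction_on with
  | H u =>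
  rw [← con_coe_pow, ← con_coe_pow, Con.eq]
  change (T.toSST lab).flow (wordPow u.toList _) = (T.toSST lab).flow (wordPow u.toList _)
  generalize u.toList = u
  by_cases hu : u = []
  · subst hu
    have : ∀ k, wordPow ([] : List A) k = [] := fun k => by simp [wordPow]
    rw [this, this]
  obtain ⟨h0, h0'⟩ := hbeh u hu 0
  obtain ⟨h1, h1'⟩ := hbeh u hu (n + 1)
  have hsplit : ∀ (w : List A) (i j : ℕ), leftMarked (w ++ wordPow u (i + j)) =
      leftMarked w ++ ((wordPow u i).map .letter ++ (wordPow u j).map .letter) := by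
    intro w i j
    rw [wordPow_add, leftMarked_append, List.map_append]
  refine flow_toSST_eq hlab ?_ (wordPow_ne_nil hu _) (fun w => ?_) (fun w c hc => ?_)
  · exact wordPow_ne_nil hu (n + n)
  · rw [forest_eq, forest_eq]
    set L := leftMarked w
    set W := fun k => (wordPow u k).map EndMarked.letter
    have e1 : leftMarked (w ++ wordPow u (n + (n + 1))) = L ++ (W n ++ W (n + 1)) := hsplit w _ _
    have e2 : leftMarked (w ++ wordPow u (n + (n + 1) + 1)) =
        L ++ (W (n + 1) ++ W (n + 1)) := by
      rw [show n + (n + 1) + 1 = n + 1 + (n + 1) by omega]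
      exact hsplit w _ _
    have e3 : leftMarked (w ++ wordPow u (n + (n + 1))) = (L ++ W (n + 1)) ++ (W n ++ []) := by
      rw [show n + (n + 1) = n + 1 + n by omega, hsplit, List.append_nil, List.append_assoc]
    have e4 : leftMarked (w ++ wordPow u (n + (n + 1) + 1)) =
        (L ++ W (n + 1)) ++ (W (n + 1) ++ []) := by
      rw [e2, List.append_nil, List.append_assoc]
    have hle : (W n).length ≤ (W (n + 1)).length := by
      simp only [W, wordPow_add u n 1, List.map_append, List.length_append]
      omega
    apply runForest_congr
    · intro c _
      -- A configuration on `L ++ W (n + 1)` is kept when the last factor grows from `u ^ n` to `u ^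
      -- (n + 1)`. One further to the right is shifted when the factor after `L` grows.
      by_cases hc : c.pos ≤ (L ++ W (n + 1)).length
      · exact ⟨c, runForest_replace h0 h0' e3 e4 (.left _ hc)⟩
      · obtain ⟨c', hc'⟩ := Outside.of_lt (k := L.length) (m := (W n).length)
          (m' := (W (n + 1)).length) (c := c) (by
            rw [List.length_append] at hc
            omega)
        exact ⟨c', runForest_replace h0 h0' e1 e2 hc'⟩
    · intro c _
      by_cases hc : c.pos ≤ (L ++ W (n + 1)).length
      · exact ⟨c, runForest_replace h0' h0 e4 e3 (.left _ hc)⟩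
      · obtain ⟨c', hc'⟩ := Outside.of_lt (k := L.length) (m := (W (n + 1)).length)
          (m' := (W n).length) (c := c) (by
            rw [List.length_append] at hc
            omega)
        exact ⟨c', runForest_replace h0' h0 e2 e1 hc'⟩
  -- Here `c` is on `⊢ w`, so the whole power may be replaced at once.
  · rw [leftMarked_append, leftMarked_append]
    refine (runForest_replace h1 h1' (z := []) ?_ ?_ (.left _ hc)).1
    · rw [List.append_nil]
    · rw [List.append_nil]

end Transducer
/-! ## Outputs -/

/-- There is a path from the first node to the second, and the labels of its nodes, without the last
one, are concatenated to the given word. -/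
inductive PathOut {α C : Type*} (f : α → Option α) (lab : α → List C) : α → α → List C → Prop
  | refl (c : α) : PathOut f lab c c []
  | step (c c' d : α) (v : List C) (h : f c = some c') (hv : PathOut f lab c' d v) :
      PathOut f lab c d (lab c ++ v)

namespace PathOut

variable {α C : Type*} {f g : α → Option α} {lab lab' : α → List C} {c c' d : α} {v w : List C}

theorem trans (h : PathOut f lab c c' v) (h' : PathOut f lab c' d w) :
    PathOut f lab c d (v ++ w) := by
  induction h with
  | refl => exact h'
  | step c c₁ d v h _ ih =>
    rw [List.append_assoc]
    exact .step _ _ _ _ h (ih h')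

theorem reach (h : PathOut f lab c d v) : Reach f c d := by
  induction h with
  | refl => exact .refl
  | step _ _ _ _ h _ ih => exact .head h ih

theorem exists_of_reach (h : Reach f c d) : ∃ v, PathOut f lab c d v := by
  induction h using Relation.ReflTransGen.head_induction_on with
  | refl => exact ⟨_, .refl _⟩
  | head h _ ih =>
    obtain ⟨v, hv⟩ := ih
    exact ⟨_, .step _ _ _ _ h hv⟩

theorem unique (hd : f d = none) (h : PathOut f lab c d v) (h' : PathOut f lab c d w) : v = w := by
  induction h generalizing w with
  | refl c =>
    cases h' with
    | refl => rfl
    | step _ _ _ _ h => simp [hd] at h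
  | step c c₁ d v h _ ih =>
    cases h' with
    | refl => simp [hd] at h
    | step _ c₂ _ v' h2 h3 =>
      rw [h] at h2
      cases h2
      rw [ih hd h3]

theorem mono (hfg : ∀ c d, f c = some d → g c = some d ∧ lab' c = lab c)
    (h : PathOut f lab c d v) : PathOut g lab' c d v := by
  induction h with
  | refl c => exact .refl c
  | step c c' d v h _ ih =>
    rw [← (hfg _ _ h).2]
    exact .step _ _ _ _ (hfg _ _ h).1 ih

theorem eq_nil (hlab : ∀ c, lab c = []) (h : PathOut f lab c d v) : v = [] := by
  induction h with
  | refl => rfl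
  | step _ _ _ _ _ _ ih => rw [hlab, ih, List.append_nil]

end PathOut

namespace Transducer

variable {A B Q : Type*} {T : Transducer A B Q}

variable (T) in
/-- The output produced in a configuration. -/
noncomputable def confLabel (x : List (EndMarked A)) : Conf Q → List B
  | .rd p i => ((cell x i).bind fun a => (T.exitδ p a).map fun t => t.1).getD []
  | .ex _ _ => []

variable (T) in
/-- The outputs of runs on `x`. -/
abbrev ConfOut (x : List (EndMarked A)) : Conf Q → Conf Q → List B → Prop :=
  PathOut (T.cstep x) (T.confLabel x)

theorem confLabel_rd {x : List (EndMarked A)} {p q : Q} {i : ℕ} {a : EndMarked A} {v : List B}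
    {m : Move} (h : cell x i = some a) (h' : T.exitδ p a = some (v, q, m)) :
    T.confLabel x (.rd p i) = v := by
  simp [confLabel, h, h']

theorem confOut_append {x : List (EndMarked A)} (y : List (EndMarked A)) {c d : Conf Q}
    {v : List B} (h : T.ConfOut x c d v) : T.ConfOut (x ++ y) c d v := by
  refine h.mono fun c d hcd => ⟨cstep_append y hcd, ?_⟩
  cases c with
  | rd p i => simp only [confLabel, cell_append_left y (i := i) (cstep_pos hcd).1]
  | ex p i => rfl

/-! ### Valuations of forests -/

variable (T) in
/-- `val` assigns outputs to the vertices of the forest of `x` in such a way that the output of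
every run that enters from the right and exits to the right is read along a path of the forest. -/
def IsValuation (x : List (EndMarked A)) (val : Set Q → List B) : Prop :=
  ∀ q p v k, T.ConfOut x (.rd q x.length) (.ex p x.length) v →
    Trace (T.runForest x).parent (T.confEntries x (.rd q x.length)) k → k.flatMap val = v

theorem mem_runForest {x : List (EndMarked A)} {c : Conf Q} {q p : Q} (hq : q ∈ T.confEntries x c)
    (hc : Reach (T.cstep x) c (.ex p x.length)) : T.confEntries x c ∈ (T.runForest x).vertices :=
  entries_mem_vertices (e := fun q => Conf.rd q x.length) hq hc

theorem runForest_target {x : List (EndMarked A)} {c : Conf Q} {q p : Q}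
    (hq : q ∈ T.confEntries x c) (hc : Reach (T.cstep x) c (.ex p x.length)) :
    (T.runForest x).target (T.confEntries x c) = some p :=
  reduct_target (e := fun q => Conf.rd q x.length) (isExit_cstep T x) hq hc

/-- The path from a vertex of a forest goes through its ancestors to the exit. -/
theorem trace_next_vert {x : List (EndMarked A)} {a : EndMarked A} {c : Conf Q} {q r : Q}
    {l : List (Node Q)} (hq : q ∈ T.confEntries x c)
    (hc : Reach (T.cstep x) c (.ex r x.length))
    (hl : Trace (T.next (T.runForest x) a) (.vert (T.confEntries x c)) l) :
    ∃ k l', l = k.map .vert ++ l' ∧ Trace (T.runForest x).parent (T.confEntries x c) k ∧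
      Trace (T.next (T.runForest x) a) (.inn r) l' := by
  have ho := isExit_cstep T x
  generalize hn : Node.vert (T.confEntries x c) = n at hl
  induction hl generalizing c with
  | last n h =>
    subst hn
    cases hp : (T.runForest x).parent (T.confEntries x c) with
    | none =>
      rw [next_vert_iff.2 ⟨mem_runForest hq hc, .inr ⟨hp, r, runForest_target hq hc, rfl⟩⟩] at h
      cases h
    | some t =>
      rw [next_vert_iff.2 ⟨mem_runForest hq hc, .inl ⟨t, hp, rfl⟩⟩] at h
      cases h
  | step n n' l h hl ih =>
    subst hn
    obtain ⟨-, (⟨t, hp, rfl⟩ | ⟨hp, r', ht, rfl⟩)⟩ := next_vert_iff.1 h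
    · obtain ⟨c', p, h1, -, rfl⟩ :=
        reduct_parent_some (e := fun q => Conf.rd q x.length) hq hp
      obtain ⟨k, l', rfl, h3, h4⟩ := ih (Relation.ReflTransGen.trans hq h1) (ho.reach hc h1) rfl
      exact ⟨_ :: k, l', rfl, .step _ _ _ hp h3, h4⟩
    · rw [runForest_target hq hc] at ht
      cases ht
      exact ⟨[_], l, rfl, .last _ hp, hl⟩

/-- The word denoted by a word with variables, if `σ` gives their values. -/
abbrev evalWord {X : Type*} (σ : Subst B X) (l : List (B ⊕ X)) : List B := eraseVars (σ.apply l)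

theorem evalWord_append {X : Type*} (σ : Subst B X) (l l' : List (B ⊕ X)) :
    evalWord σ (l ++ l') = evalWord σ l ++ evalWord σ l' := by
  simp [evalWord, eraseVars, Subst.apply]

theorem evalWord_flatMap {X α : Type*} (σ : Subst B X) (f : α → List (B ⊕ X)) (l : List α) :
    evalWord σ (l.flatMap f) = l.flatMap fun s => evalWord σ (f s) := by
  induction l with
  | nil => rfl
  | cons a l ih => rw [List.flatMap_cons, evalWord_append, ih, List.flatMap_cons]

theorem evalWord_inl {X : Type*} (σ : Subst B X) (v : List B) :
    evalWord σ (v.map Sum.inl) = v := by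
  induction v with
  | nil => rfl
  | cons b v ih =>
    rw [List.map_cons, ← List.singleton_append, evalWord_append, ih]
    rfl

theorem evalWord_var {X : Type*} (σ : Subst B X) (x : X) :
    evalWord σ [Sum.inr x] = eraseVars (σ x) := by
  simp [evalWord, Subst.apply]

theorem nodeLabel_inn {l : Set Q → T.Var} {a : EndMarked A} {p q : Q} {v : List B} {m : Move}
    (h : T.exitδ p a = some (v, q, m)) : T.nodeLabel l a (.inn p) = v.map Sum.inl := by
  simp [nodeLabel, h]

/-- A path in the extension alternates between transitions on `a`, whose output is the label, and
passages through a tree from a leaf to its root. Such a passage stands for a run over `x` from the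
right to the right, and its output is given by the valuation. The bound `n` serves for the
induction, since a passage is removed as a whole. -/
theorem confOut_of_trace {x : List (EndMarked A)} {a : EndMarked A} {σ : Subst B T.Var}
    {lab : Set Q → T.Var} (hval : T.IsValuation x fun s => eraseVars (σ (lab s)))
    {n : ℕ} {q p : Q} {l : List (Node Q)} (hn : l.length ≤ n)
    (hl : Trace (T.next (T.runForest x) a) (.inn q) l)
    (hp : Reach (T.next (T.runForest x) a) (.inn q) (.out p)) :
    T.ConfOut (x ++ [a]) (.rd q (x.length + 1)) (.ex p (x.length + 1))
      (l.flatMap fun s => evalWord σ (T.nodeLabel lab a s)) := by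
  have ho := isExit_next (T := T) (T.runForest x) a
  induction n generalizing q l with
  | zero =>
    cases hl <;> simp at hn
  | succ n ih =>
    cases hl with
    | last _ h => cases Reach.eq_of_none h hp
    | step _ n' l h hl =>
      have hp' := ho.reach hp (.single h)
      have hn' : l.length ≤ n := by simpa using hn
      obtain ⟨v, r, m, h1, h2⟩ := next_inn_iff.1 h
      have h3 : T.cstep (x ++ [a]) (.rd q (x.length + 1)) = some (m.conf r (x.length + 1)) :=
        cstep_rd_iff.2 ⟨a, v, r, m, cell_last x a, h1, rfl⟩
      rw [List.flatMap_cons, nodeLabel_inn h1, evalWord_inl,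
        ← confLabel_rd (cell_last x a) h1]
      refine .step _ _ _ _ h3 ?_
      rcases h2 with ⟨rfl, rfl⟩ | ⟨rfl, rfl⟩ | ⟨rfl, t, ht, rfl⟩
      · cases Reach.eq_of_none (ho.none r) hp'
        cases hl with
        | last => exact .refl _
        | step _ _ _ h => cases h
      · exact ih hn' hl hp'
      · obtain ⟨rfl, r', hr'⟩ := reduct_leaf_some ht
        obtain ⟨k, l', rfl, hk, hl'⟩ :=
          trace_next_vert (T := T) (q := r) (c := .rd r x.length) .refl hr' hl
        obtain ⟨w, hw⟩ := PathOut.exists_of_reach (lab := T.confLabel x) hr'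
        have hv := hval _ _ _ _ hw hk
        have hmem : Node.inn r' ∈ k.map Node.vert ++ l' := by
          rw [List.mem_append, hl'.mem_iff]
          exact .inr .refl
        rw [hl.mem_iff] at hmem
        have := ih (by rw [List.length_append] at hn'; omega) hl' (ho.reach hp' hmem)
        rw [List.flatMap_append, List.flatMap_map]
        have hv' : (k.flatMap fun s => evalWord σ (T.nodeLabel lab a (.vert s))) = w := by
          simp only [nodeLabel, evalWord_var]
          exact hv
        rw [hv']
        simp only [Move.conf, Nat.add_sub_cancel]
        exact (confOut_append [a] hw).trans (.step _ _ _ _ (cstep_ex (by simp)) this)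

/-- The labels of the vertices define a valuation of the extended forest. -/
theorem isValuation_extend {x : List (EndMarked A)} (a : EndMarked A) {σ : Subst B T.Var}
    {lab : Set Q → T.Var} (hval : T.IsValuation x fun s => eraseVars (σ (lab s)))
    {val' : Set Q → List B} (hval' : ∀ t ∈ (T.runForest (x ++ [a])).vertices,
      val' t = evalWord σ (T.vertexLabel (T.runForest x) lab a t)) :
    T.IsValuation (x ++ [a]) val' := by
  classical
  intro q p v k hv hk
  have S := isSimulation_corr T x a
  have ho := isExit_next (T := T) (T.runForest x) a
  have hc := S.entry q
  have h1 := (S.reach_exit_iff hc p).1 hv.reach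
  have h2 := S.entries_iff hc hv.reach
  obtain ⟨l, hl⟩ := ho.exists_trace h1
  obtain ⟨k', hk', h3, h4⟩ := exists_parent_trace (T.nodeLabel lab a) ho hl .refl h1
  rw [← extend_eq, extend_runForest, h2] at hk'
  rw [hk.unique hk']
  have h5 := confOut_of_trace hval le_rfl hl h1
  -- Regroups the output of the whole path by the vertices of the new forest.
  rw [← evalWord_flatMap, ← h4, evalWord_flatMap] at h5
  have h6 : k'.flatMap val' = k'.flatMap fun t => evalWord σ
      ((l.filter fun s => T.inSet (T.runForest x) a s = t).flatMap (T.nodeLabel lab a)) := by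
    refine List.flatMap_congr fun t ht => ?_
    obtain ⟨h7, h8⟩ := h3 t ht
    rw [← vertexLabel_eq h8 (h7 .refl) hl]
    refine hval' t ?_
    rw [← extend_runForest]
    exact h8
  rw [h6]
  refine PathOut.unique ((isExit_cstep T (x ++ [a])).none p) (lab := T.confLabel (x ++ [a]))
    (c := .rd q (x ++ [a]).length) ?_ hv
  rw [show (x ++ [a]).length = x.length + 1 by simp]
  exact h5

/-- On `⊢` alone all runs must have empty output, since the variables are initially empty; this is
what silence on `⊢` is needed for. -/
theorem isValuation_runSubst (hs : T.SilentAtLeft) {lab : T.SSTState → Set Q → T.Var}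
    (hlab : T.IsLabeling lab) {G : T.SSTState} (hG : G.1 = T.forest []) (w : List A) :
    T.IsValuation (leftMarked w)
      fun s => eraseVars (T.runSubst lab G w (lab (T.read G w) s)) := by
  induction w using List.reverseRecOn with
  | nil =>
    intro q p v k hv _
    have hnil : ∀ c, T.confLabel (leftMarked []) c = [] := by
      intro c
      cases c with
      | ex q i => rfl
      | rd q i =>
        cases hd : T.cstep (leftMarked []) (.rd q i) with
        | none =>
          cases hi : cell (leftMarked ([] : List A)) i with
          | none => simp [confLabel, hi]
          | some a =>
            cases ha : T.exitδ q a with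
            | none => simp [confLabel, hi, ha]
            | some t => simp [cstep, hi, ha] at hd
        | some d =>
          obtain ⟨a, v, r, m, h1, h2, -⟩ := cstep_rd_iff.1 hd
          rw [confLabel_rd h1 h2]
          have : a = .lend := by
            obtain ⟨h3, h4⟩ := cell_pos h1
            obtain rfl : i = 1 := by simp [leftMarked] at h4; omega
            simpa [cell, leftMarked, eq_comm] using h1
          subst this
          exact hs _ _ _ _ h2
    rw [PathOut.eq_nil hnil hv]
    simp [runSubst, eraseVars]
  | append_singleton w a ih =>
    have hm : leftMarked (w ++ [a]) = leftMarked w ++ [.letter a] := leftMarked_append w [a]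
    rw [hm]
    refine isValuation_extend (.letter a) ih ?_
    intro t ht
    have hG' := read_val hG w
    rw [List.nil_append, forest_eq] at hG'
    have ht' : t ∈ (T.succ (T.read G w) a).1.vertices := by
      change t ∈ (T.extend (T.read G w).1 _).vertices
      rwa [hG', extend_runForest]
    rw [read_append, show T.read (T.read G w) [a] = T.succ (T.read G w) a from rfl, runSubst_snoc,
      Subst.comp, update_lab hlab ht', hG']

/-! ### The transduction -/

/-- The tape `⊢ u ⊣`. -/
def marked (u : List A) : List (EndMarked A) := leftMarked u ++ [.rend]

theorem length_marked (u : List A) : (marked u).length = u.length + 2 := by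
  simp [marked, leftMarked]

theorem cell_marked (u : List A) (i : ℕ) : cell (marked u) (i + 1) = tape u i := by
  simp [cell, marked, leftMarked, tape]

theorem tape_eq_rend_iff {u : List A} {i : ℕ} : tape u i = some .rend ↔ i = u.length + 1 := by
  constructor
  · intro h
    cases i with
    | zero => simp [tape] at h
    | succ i =>
      simp only [tape, List.getElem?_cons_succ, List.getElem?_append, List.length_map] at h
      split_ifs at h with hi
      · simp at h
      · have := (List.getElem?_eq_some_iff.1 h).1
        simp at this
        omega
  · rintro rfl
    simp [tape]

theorem exitδ_of_not_accepting {u : List A} {c : Q × ℕ} {a : EndMarked A}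
    (h : ¬ T.Accepting u c) (ha : tape u c.2 = some a) : T.exitδ c.1 a = T.δ c.1 a := by
  cases a with
  | lend => rfl
  | letter a => rfl
  | rend =>
    rw [tape_eq_rend_iff] at ha
    rw [exitδ, if_neg fun h' => h ⟨ha, h'⟩]

/-- To stop and accept becomes to leave the tape to the right from `⊣`, so accepting runs are those
that exit. Positions are shifted by one, because `cell` counts from `1` and `tape` from `0`. -/
theorem confOut_of_accRun {u : List A} {c : Q × ℕ} {v : List B} (h : T.AccRun u c v) :
    ∃ p, T.ConfOut (marked u) (.rd c.1 (c.2 + 1)) (.ex p (marked u).length) v := by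
  induction h with
  | done c h =>
    have h1 : cell (marked u) (c.2 + 1) = some .rend := by
      rw [cell_marked, tape_eq_rend_iff]
      exact h.1
    have h2 : T.exitδ c.1 .rend = some ([], c.1, .right) := by
      rw [exitδ, if_pos h.2]
    refine ⟨c.1, ?_⟩
    have := PathOut.step (lab := T.confLabel (marked u)) _ _ _ _
      (cstep_rd_iff.2 ⟨_, _, _, _, h1, h2, rfl⟩) (.refl _)
    rw [confLabel_rd h1 h2] at this
    rw [length_marked]
    have e : u.length + 2 = c.2 + 1 := by rw [h.1]
    rw [e]
    exact this
  | step c c' v w h hs _ ih =>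
    obtain ⟨p, hp⟩ := ih
    obtain ⟨a, m, h1, h2, h3⟩ := hs
    rw [← exitδ_of_not_accepting h h1] at h2
    have h1' := cell_marked u c.2
    rw [h1] at h1'
    refine ⟨p, ?_⟩
    rw [← confLabel_rd h1' h2]
    refine .step _ _ _ _ (cstep_rd_iff.2 ⟨_, _, _, _, h1', h2, rfl⟩) ?_
    cases m with
    | left =>
      have h3 : c.2 = c'.2 + 1 := h3
      rw [h3]
      exact hp
    | stay =>
      have h3 : c'.2 = c.2 := h3
      rw [h3] at hp
      exact hp
    | right =>
      have h3 : c'.2 = c.2 + 1 := h3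
      rw [h3] at hp
      refine .step _ _ _ _ (cstep_ex ?_) hp
      have h4 := (cell_pos h1').2
      rcases Nat.lt_or_eq_of_le h4 with h4 | h4
      · exact h4
      · rw [length_marked] at h4
        have h5 : c.2 = u.length + 1 := by omega
        rw [tape_eq_rend_iff.2 h5] at h1
        cases h1
        rw [exitδ, if_neg fun h' => h ⟨h5, h'⟩] at h2
        exact absurd h2 (T.rend_ne_right _ _ _)

theorem accRun_of_confOut {u : List A} {c d : Conf Q} {p : Q} {v : List B}
    (hd : d = .ex p (marked u).length) (h : T.ConfOut (marked u) c d v) :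
    match c with
    | .rd q i => ∀ j, i = j + 1 → T.AccRun u (q, j) v
    | .ex q i => if i < (marked u).length then T.AccRun u (q, i) v else v = [] := by
  induction h with
  | refl c =>
    subst hd
    simp
  | step c c' d v h _ ih =>
    specialize ih hd
    cases c with
    | ex q i =>
      obtain ⟨h1, rfl⟩ := cstep_ex_iff.1 h
      simp only [h1, if_true]
      exact ih i rfl
    | rd q i =>
      rintro j rfl
      obtain ⟨a, w, r, m, h1, h2, rfl⟩ := cstep_rd_iff.1 h
      rw [confLabel_rd h1 h2]
      have hj := (cell_pos h1).2
      rw [cell_marked] at h1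
      rw [length_marked] at hj ih
      by_cases hacc : T.Accepting u (q, j)
      · have h3 : j = u.length + 1 := hacc.1
        rw [tape_eq_rend_iff.2 h3] at h1
        cases h1
        rw [exitδ, if_pos hacc.2] at h2
        cases h2
        simp only [Move.conf, h3, lt_irrefl, if_false] at ih
        rw [ih]
        exact .done _ hacc
      · rw [exitδ_of_not_accepting hacc h1] at h2
        cases m with
        | left =>
          obtain ⟨j, rfl⟩ : ∃ k, j = k + 1 := by
            cases j with
            | zero =>
              simp only [tape, List.getElem?_cons_zero, Option.some.injEq] at h1
              subst h1
              exact absurd h2 (T.lend_ne_left _ _ _)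
            | succ k => exact ⟨k, rfl⟩
          exact .step _ (r, j) _ _ hacc ⟨a, _, h1, h2, rfl⟩ (ih j rfl)
        | stay => exact .step _ (r, j) _ _ hacc ⟨a, _, h1, h2, rfl⟩ (ih j rfl)
        | right =>
          have h4 : j + 1 < u.length + 2 := by
            rcases Nat.lt_or_eq_of_le hj with h5 | h5
            · exact h5
            · have h6 : j = u.length + 1 := by omega
              rw [tape_eq_rend_iff.2 h6] at h1
              cases h1
              exact absurd h2 (T.rend_ne_right _ _ _)
          simp only [Move.conf, h4, if_true] at ih
          exact .step _ (r, j + 1) _ _ hacc ⟨a, _, h1, h2, rfl⟩ ih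

theorem realizesFromRight_iff {u : List A} {v : List B} : T.RealizesFromRight u v ↔
    ∃ p, T.ConfOut (marked u) (.rd T.init (marked u).length) (.ex p (marked u).length) v := by
  constructor
  · intro h
    obtain ⟨p, hp⟩ := confOut_of_accRun h
    refine ⟨p, ?_⟩
    rw [length_marked] at hp ⊢
    exact hp
  · rintro ⟨p, hp⟩
    have := accRun_of_confOut rfl hp
    simp only at this
    exact this _ (length_marked u)

/-- The tape is left to the right only by the transitions that `exitδ` adds in final states. So the
test in `sstOut` succeeds whenever the run from the right end in the initial state exits. -/
theorem mem_final_of_reach {u : List A} {q p : Q} {i : ℕ}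
    (h : Reach (T.cstep (marked u)) (.rd q i) (.ex p (marked u).length)) : p ∈ T.final := by
  rcases Relation.ReflTransGen.cases_tail h with h | ⟨c, -, h⟩
  · cases h
  · cases c with
    | ex q i => simp [cstep_ex_iff] at h
    | rd r j =>
      obtain ⟨a, w, r', m, h1, h2, h3⟩ := cstep_rd_iff.1 h
      cases m <;> simp only [Move.conf, Conf.ex.injEq, reduceCtorEq] at h3
      obtain ⟨rfl, rfl⟩ := h3
      rw [length_marked, cell_marked, tape_eq_rend_iff.2 rfl] at h1
      cases h1
      unfold exitδ at h2
      split_ifs at h2 with hf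
      · cases h2
        exact hf
      · exact absurd h2 (T.rend_ne_right _ _ _)

theorem realizes_toSST (hs : T.SilentAtLeft) {lab : T.SSTState → Set Q → T.Var}
    (hlab : T.IsLabeling lab) (u : List A) (v : List B) :
    (T.toSST lab).Realizes u v ↔ T.RealizesFromRight u v := by
  have := T.finite_states
  set G : T.SSTState := (T.toSST lab).init with hGdef
  have hG : G.1 = T.forest [] := rfl
  have hG' := read_val hG u
  rw [List.nil_append, forest_eq] at hG'
  have hval := isValuation_extend .rend (isValuation_runSubst hs hlab hG u) fun t _ => rfl
  have hext : T.extend (T.read G u).1 .rend = T.runForest (marked u) := by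
    rw [hG', extend_runForest, marked]
  change T.IsValuation (marked u) _ at hval
  have ho := isExit_cstep T (marked u)
  have hout : (T.toSST lab).out = T.sstOut lab := rfl
  -- the output, if the run exits
  have key : ∀ p w, T.ConfOut (marked u) (.rd T.init (marked u).length)
      (.ex p (marked u).length) w → ∃ l, T.sstOut lab (T.read G u) = some l ∧
        evalWord (T.runSubst lab G u) l = w := by
    intro p w hw
    have h1 : (T.runForest (marked u)).leaf T.init =
        some (T.confEntries (marked u) (.rd T.init (marked u).length)) :=
      reduct_leaf (e := fun q => Conf.rd q (marked u).length) hw.reach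
    have h2 : (T.runForest (marked u)).target
        (T.confEntries (marked u) (.rd T.init (marked u).length)) = some p :=
      runForest_target (q := T.init) .refl hw.reach
    obtain ⟨l, hl⟩ := ho.exists_trace hw.reach
    obtain ⟨k, hk, -⟩ := exists_parent_trace (e := fun q => Conf.rd q (marked u).length)
      (q := T.init) (fun _ => ([] : List B)) ho hl .refl hw.reach
    have h3 : pathFrom (T.runForest (marked u)).parent T.fuel
        (T.confEntries (marked u) (.rd T.init (marked u).length)) = k := by
      refine hk.pathFrom_eq (hk.length_le.trans ?_)
      rw [card_set, fuel]
      omega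
    have h4 := hval _ _ _ _ hw hk
    have h5 : T.sstOut lab (T.read G u) = some ((pathFrom (T.runForest (marked u)).parent T.fuel
        (T.confEntries (marked u) (.rd T.init (marked u).length))).flatMap
          (T.vertexLabel (T.read G u).1 (lab (T.read G u)) .rend)) := by
      simp only [sstOut, hext, h1, h2]
      rw [if_pos ⟨p, mem_final_of_reach hw.reach, by rw [hext, h2]⟩]
    refine ⟨_, h5, ?_⟩
    rw [h3, hG', evalWord_flatMap]
    exact h4
  rw [realizesFromRight_iff]
  constructor
  · rintro ⟨r, σ, l, h1, h2, rfl⟩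
    rw [← hGdef, run_toSST] at h1
    cases h1
    rw [hout] at h2
    cases hleaf : (T.runForest (marked u)).leaf T.init with
    | none => simp [sstOut, hext, hleaf] at h2
    | some s =>
      obtain ⟨-, p, hp⟩ := reduct_leaf_some hleaf
      obtain ⟨w, hw⟩ := PathOut.exists_of_reach (lab := T.confLabel (marked u)) hp
      obtain ⟨l', h3, rfl⟩ := key p w hw
      rw [h2] at h3
      cases h3
      exact ⟨p, hw⟩
  · rintro ⟨p, hp⟩
    obtain ⟨l, h1, rfl⟩ := key p v hp
    exact ⟨_, _, l, run_toSST u, h1, rfl⟩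

end Transducer
/-! ## Labelings -/

/-- A family of nonempty subsets of a nonempty set with `n` elements, any two of which are nested or
disjoint, has at most `2 n - 1` members. -/
theorem ncard_laminar_le {α : Type*} [Finite α] (n : ℕ) (S : Set α) (hS : S.Nonempty)
    (hn : S.ncard ≤ n) (F : Set (Set α)) (hF : ∀ s ∈ F, s.Nonempty ∧ s ⊆ S)
    (hl : ∀ s ∈ F, ∀ t ∈ F, (s ∩ t).Nonempty → s ⊆ t ∨ t ⊆ s) :
    F.ncard + 1 ≤ 2 * S.ncard := by
  induction n generalizing S F with
  | zero =>
    have := (Set.ncard_pos (Set.toFinite S)).2 hS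
    omega
  | succ n ih =>
    have hS1 : 1 ≤ S.ncard := (Set.ncard_pos (Set.toFinite S)).2 hS
    have hsub : F ⊆ insert S (F \ {S}) := by
      intro s hs
      by_cases h : s = S
      · exact .inl h
      · exact .inr ⟨hs, h⟩
    have h1 : F.ncard ≤ (F \ {S}).ncard + 1 :=
      (Set.ncard_le_ncard hsub (Set.toFinite _)).trans (Set.ncard_insert_le _ _)
    rcases (F \ {S}).eq_empty_or_nonempty with he | hne
    · rw [he, Set.ncard_empty] at h1
      omega
    -- By laminarity each member other than `S` is contained in the maximal member `m` or disjoint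
    -- from it. With `S` itself the number of members is at most `(2 |m| - 1) + (2 |S \ m| - 1) + 1
    -- = 2 |S| - 1`.
    obtain ⟨m, hm⟩ := (Set.toFinite (F \ {S})).exists_maximal hne
    have hmF := hm.prop
    have hmS : m ⊂ S := (hF m hmF.1).2.ssubset_of_ne hmF.2
    have hm_lt := Set.ncard_lt_ncard hmS (Set.toFinite S)
    have hdiff := Set.ncard_sdiff_add_ncard_of_subset hmS.1 (Set.toFinite S)
    have hm0 : 1 ≤ m.ncard := (Set.ncard_pos (Set.toFinite m)).2 (hF m hmF.1).1
    have hDne : (S \ m).Nonempty := Set.nonempty_of_ssubset hmS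
    have h2 := ih m (hF m hmF.1).1 (by omega) {s ∈ F | s ⊆ m} (fun s hs => ⟨(hF s hs.1).1, hs.2⟩)
      fun s hs t ht => hl s hs.1 t ht.1
    have h3 := ih (S \ m) hDne (by omega) {s ∈ F | s ⊆ S \ m}
      (fun s hs => ⟨(hF s hs.1).1, hs.2⟩) fun s hs t ht => hl s hs.1 t ht.1
    have h4 : F \ {S} ⊆ {s ∈ F | s ⊆ m} ∪ {s ∈ F | s ⊆ S \ m} := by
      intro s hs
      rcases (s ∩ m).eq_empty_or_nonempty with h5 | h5
      · refine .inr ⟨hs.1, fun x hx => ⟨(hF s hs.1).2 hx, fun hxm => ?_⟩⟩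
        have : x ∈ s ∩ m := ⟨hx, hxm⟩
        rw [h5] at this
        exact this
      · rcases hl s hs.1 m hmF.1 h5 with h6 | h6
        · exact .inl ⟨hs.1, h6⟩
        · exact .inl ⟨hs.1, hm.le_of_ge hs h6⟩
    have h5 := (Set.ncard_le_ncard h4 (Set.toFinite _)).trans (Set.ncard_union_le _ _)
    omega

namespace Transducer

variable {A B Q : Type*} {T : Transducer A B Q}

variable (T) in
theorem exists_isLabeling : ∃ lab, T.IsLabeling lab := by
  have := T.finite_states
  have : Nonempty Q := ⟨T.init⟩
  have hpos : 0 < Nat.card Q := Nat.card_pos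
  have key : ∀ G : T.SSTState, ∃ f : Set Q → T.Var, Set.InjOn f G.1.vertices := by
    intro G
    have h1 : G.1.vertices.ncard + 1 ≤ 2 * (Set.univ : Set Q).ncard := by
      obtain ⟨w, hw⟩ := G.2
      rw [hw, forest_eq]
      refine ncard_laminar_le _ _ Set.univ_nonempty le_rfl _
        (fun s hs => ⟨hs.1, Set.subset_univ _⟩) ?_
      rintro s hs t ht ⟨q, hqs, hqt⟩
      exact reduct_laminar hs ht hqs hqt
    rw [Set.ncard_univ] at h1
    have h2 : Nat.card G.1.vertices ≤ Nat.card T.Var := by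
      rw [Nat.card_coe_set_eq, Nat.card_eq_fintype_card, Fintype.card_fin]
      omega
    have := Fintype.ofFinite G.1.vertices
    rw [Nat.card_eq_fintype_card, Nat.card_eq_fintype_card] at h2
    obtain ⟨e⟩ := Function.Embedding.nonempty_of_card_le h2
    classical
    refine ⟨fun s => if h : s ∈ G.1.vertices then e ⟨s, h⟩ else ⟨0, by omega⟩, ?_⟩
    intro s hs t ht h
    simp only [hs, ht, dif_pos] at h
    simpa using e.injective h
  choose f hf using key
  exact ⟨f, hf⟩

/-! ## The normalized machine -/

theorem silentAtLeft_normalize : T.normalize.SilentAtLeft := by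
  rintro (p | p | _) v q m h
  · simp only [normalize, normδ, Option.map_eq_some_iff, Prod.mk.injEq] at h
    obtain ⟨-, -, rfl, -⟩ := h
    rfl
  · simp [normalize, normδ] at h
  · simp only [normalize, normδ, Option.some.injEq, Prod.mk.injEq] at h
    exact h.1.symm

theorem accepting_normalize_sim {u : List A} {p : Q} {i : ℕ} :
    T.normalize.Accepting u (.sim p, i) ↔ T.Accepting u (p, i) := by
  simp [Accepting, normalize]

theorem not_accepting_normalize_emit {u : List A} {p : Q} {i : ℕ} :
    ¬ T.normalize.Accepting u (.emit p, i) := by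
  simp [Accepting, normalize]

theorem not_accepting_normalize_rewind {u : List A} {i : ℕ} :
    ¬ T.normalize.Accepting u (.rewind, i) := by
  simp [Accepting, normalize]

theorem tape_eq_lend_iff {u : List A} {i : ℕ} : tape u i = some .lend ↔ i = 0 := by
  cases i with
  | zero => simp [tape]
  | succ i =>
    simp only [tape, List.getElem?_cons_succ, List.getElem?_append, List.length_map]
    split_ifs with hi
    · simp
    · rw [List.getElem?_singleton]
      split_ifs <;> simp

theorem exists_tape {u : List A} {i : ℕ} (h : i ≤ u.length + 1) : ∃ a, tape u i = some a := by
  unfold tape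
  rw [List.getElem?_eq_getElem (by simp; omega)]
  exact ⟨_, rfl⟩

theorem normδ_sim {p : Q} {a : EndMarked A} (ha : a ≠ .lend) :
    T.normalize.δ (.sim p) a = (T.δ p a).map fun t => (t.1, .sim t.2.1, t.2.2) := by
  cases a with
  | lend => exact absurd rfl ha
  | letter a => rfl
  | rend => rfl

theorem normδ_emit {p q : Q} {a : EndMarked A} (ha : a ≠ .lend) {v : List B} {m : Move}
    (h : T.δ p .lend = some (v, q, m)) :
    T.normalize.δ (.emit p) a =
      some (v, .sim q, match m with | .right => .stay | _ => .left) := by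
  cases a with
  | lend => exact absurd rfl ha
  | letter a => cases m <;> simp [normalize, normδ, h]
  | rend => cases m <;> simp [normalize, normδ, h]

theorem normδ_emit_none {p : Q} {a : EndMarked A} (h : T.δ p .lend = none) :
    T.normalize.δ (.emit p) a = none := by
  cases a <;> simp [normalize, normδ, h]

theorem normδ_rewind {a : EndMarked A} (ha : a ≠ .lend) :
    T.normalize.δ .rewind a = some ([], .rewind, .left) := by
  cases a with
  | lend => exact absurd rfl ha
  | letter a => rfl
  | rend => rfl

theorem accRun_normalize_rewind {u : List A} {v : List B} {i : ℕ} (hi : i ≤ u.length + 1)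
    (h : T.normalize.AccRun u (.sim T.init, 0) v) : T.normalize.AccRun u (.rewind, i) v := by
  induction i with
  | zero =>
    rw [← List.nil_append v]
    exact .step _ (.sim T.init, 0) _ _ not_accepting_normalize_rewind
      ⟨.lend, .stay, tape_eq_lend_iff.2 rfl, rfl, rfl⟩ h
  | succ i ih =>
    obtain ⟨a, ha⟩ := exists_tape hi
    have hne : a ≠ .lend := by
      rintro rfl
      rw [tape_eq_lend_iff] at ha
      omega
    rw [← List.nil_append v]
    exact .step _ (.rewind, i) _ _ not_accepting_normalize_rewind
      ⟨a, .left, ha, normδ_rewind hne, rfl⟩ (ih (by omega))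

/-- A step of `T` on `⊢` becomes two: a silent move to the next cell, and a step from there which
produces the output and, going left or staying, ends where `T` would be. -/
theorem accRun_normalize {u : List A} {c : Q × ℕ} {v : List B} (h : T.AccRun u c v) :
    T.normalize.AccRun u (.sim c.1, c.2) v := by
  induction h with
  | done c h => exact .done _ (accepting_normalize_sim.2 h)
  | step c c' v w h hs _ ih =>
    have h' : ¬ T.normalize.Accepting u (.sim c.1, c.2) := fun h' => h (accepting_normalize_sim.1 h')
    obtain ⟨a, m, h1, h2, h3⟩ := hs
    by_cases ha : a = .lend
    · subst ha
      have hc : c.2 = 0 := tape_eq_lend_iff.1 h1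
      obtain ⟨a, h4⟩ := exists_tape (u := u) (i := 1) (by omega)
      have hne : a ≠ .lend := by
        rintro rfl
        rw [tape_eq_lend_iff] at h4
        omega
      rw [← List.nil_append (v ++ w)]
      refine .step _ (.emit c.1, 1) _ _ h' ⟨.lend, .right, h1, ?_, by simp [Move.Moves, hc]⟩ ?_
      · simp [normalize, normδ, h2]
      · refine .step _ (.sim c'.1, c'.2) _ _ not_accepting_normalize_emit
          ⟨a, _, h4, normδ_emit hne h2, ?_⟩ ih
        cases m with
        | left => exact absurd h2 (T.lend_ne_left _ _ _)
        | stay =>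
          simp only [Move.Moves] at h3 ⊢
          omega
        | right =>
          simp only [Move.Moves] at h3 ⊢
          omega
    · refine .step _ (.sim c'.1, c'.2) _ _ h' ⟨a, m, h1, ?_, h3⟩ ih
      rw [normδ_sim ha]
      exact Option.map_eq_some_iff.2 ⟨_, h2, rfl⟩

theorem accRun_of_normalize {u : List A} {c : NormState Q × ℕ} {v : List B}
    (h : T.normalize.AccRun u c v) :
    match c.1 with
    | .sim p => T.AccRun u (p, c.2) v
    | .emit p => c.2 = 1 → T.AccRun u (p, 0) v
    | .rewind => T.AccRun u (T.init, 0) v := by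
  induction h with
  | done c h =>
    obtain ⟨p | p | _, i⟩ := c
    · exact .done _ (accepting_normalize_sim.1 h)
    · exact absurd h not_accepting_normalize_emit
    · exact absurd h not_accepting_normalize_rewind
  | step c c' v w h hs _ ih =>
    obtain ⟨a, m, h1, h2, h3⟩ := hs
    obtain ⟨p | p | _, i⟩ := c
    · by_cases ha : a = .lend
      · subst ha
        have hi : i = 0 := tape_eq_lend_iff.1 h1
        subst hi
        simp only [normalize, normδ, Option.map_eq_some_iff, Prod.mk.injEq] at h2
        obtain ⟨t, ht, rfl, h4, rfl⟩ := h2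
        rw [← h4] at ih
        exact ih h3
      · rw [normδ_sim ha, Option.map_eq_some_iff] at h2
        obtain ⟨t, ht, h4⟩ := h2
        simp only [Prod.mk.injEq] at h4
        obtain ⟨rfl, h5, rfl⟩ := h4
        rw [← h5] at ih
        exact .step _ (t.2.1, c'.2) _ _ (fun h' => h (accepting_normalize_sim.2 h'))
          ⟨a, _, h1, ht, h3⟩ ih
    · intro hi
      simp only at hi h1
      subst hi
      have ha : a ≠ .lend := by
        rintro rfl
        rw [tape_eq_lend_iff] at h1
        omega
      cases hp : T.δ p .lend with
      | none =>
        rw [normδ_emit_none hp] at h2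
        cases h2
      | some t =>
        obtain ⟨v', q, m'⟩ := t
        rw [normδ_emit ha hp] at h2
        simp only [Option.some.injEq, Prod.mk.injEq] at h2
        obtain ⟨rfl, h5, rfl⟩ := h2
        rw [← h5] at ih
        refine .step _ (q, c'.2) _ _ (by simp [Accepting])
          ⟨.lend, m', tape_eq_lend_iff.2 rfl, hp, ?_⟩ ih
        cases m' with
        | left => exact absurd hp (T.lend_ne_left _ _ _)
        | stay =>
          simp only [Move.Moves] at h3 ⊢
          omega
        | right =>
          simp only [Move.Moves] at h3 ⊢
          omega
    · by_cases ha : a = .lend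
      · subst ha
        have hi : i = 0 := tape_eq_lend_iff.1 h1
        subst hi
        simp only [normalize, normδ, Option.some.injEq, Prod.mk.injEq] at h2
        obtain ⟨rfl, h5, rfl⟩ := h2
        have h3 : c'.2 = 0 := h3
        rw [← h5, h3] at ih
        exact ih
      · rw [normδ_rewind ha] at h2
        simp only [Option.some.injEq, Prod.mk.injEq] at h2
        obtain ⟨rfl, h5, rfl⟩ := h2
        rw [← h5] at ih
        exact ih

theorem realizesFromRight_normalize (u : List A) (v : List B) :
    T.normalize.RealizesFromRight u v ↔ T.Realizes u v :=
  ⟨accRun_of_normalize, fun h => accRun_normalize_rewind le_rfl (accRun_normalize h)⟩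

/-! ### Behaviors of the normalized machine -/

theorem wordCell_ne_lend {u : List A} {i : ℕ} {a : EndMarked A} (h : wordCell u i = some a) :
    a ≠ .lend := by
  cases i with
  | zero => simp [wordCell] at h
  | succ i =>
    rw [wordCell, List.getElem?_map, Option.map_eq_some_iff] at h
    obtain ⟨a', -, rfl⟩ := h
    simp

theorem exists_wordCell {u : List A} {i : ℕ} (h1 : 1 ≤ i) (h2 : i ≤ u.length) :
    ∃ a, wordCell u i = some a := by
  obtain ⟨i, rfl⟩ : ∃ j, i = j + 1 := ⟨i - 1, by omega⟩
  rw [wordCell, List.getElem?_eq_getElem (by simp; omega)]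
  exact ⟨_, rfl⟩

/-- Bare words do not contain `⊢`, the only symbol on which a simulating state deviates from `T`. -/
theorem reach_normalize_sim {u : List A} {p : Q} {i : ℕ} {s : NormState Q} {j : ℕ} :
    Relation.ReflTransGen (T.normalize.WordStep u) (.sim p, i) (s, j) ↔
      ∃ q, s = .sim q ∧ Relation.ReflTransGen (T.WordStep u) (p, i) (q, j) := by
  constructor
  · intro h
    generalize hd : (s, j) = d at h
    induction h generalizing s j with
    | refl =>
      cases hd
      exact ⟨p, rfl, .refl⟩
    | @tail b c _ h ih =>
      subst hd
      obtain ⟨q, h1, h2⟩ := ih rfl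
      obtain ⟨v, a, m, h3, h4, h5⟩ := h
      rw [h1, normδ_sim (wordCell_ne_lend h3), Option.map_eq_some_iff] at h4
      obtain ⟨t, ht, h4⟩ := h4
      simp only [Prod.mk.injEq] at h4
      obtain ⟨rfl, h4, rfl⟩ := h4
      exact ⟨t.2.1, h4.symm, h2.tail ⟨_, a, _, h3, ht, h5⟩⟩
  · rintro ⟨q, rfl, h⟩
    refine Relation.ReflTransGen.lift (fun c : Q × ℕ => (NormState.sim c.1, c.2)) ?_ _ _ h
    rintro b c ⟨v, a, m, h3, h4, h5⟩
    exact ⟨v, a, m, h3, by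
      rw [normδ_sim (wordCell_ne_lend h3)]; exact Option.map_eq_some_iff.2 ⟨_, h4, rfl⟩, h5⟩

theorem reach_normalize_rewind {u : List A} {i : ℕ} (hi : i ≤ u.length) {s : NormState Q} {j : ℕ} :
    Relation.ReflTransGen (T.normalize.WordStep u) (.rewind, i) (s, j) ↔
      s = .rewind ∧ j ≤ i := by
  constructor
  · intro h
    generalize hd : (s, j) = d at h
    induction h generalizing s j with
    | refl =>
      cases hd
      exact ⟨rfl, le_rfl⟩
    | @tail b c _ h ih =>
      subst hd
      obtain ⟨h1, h2⟩ := ih rfl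
      obtain ⟨v, a, m, h3, h4, h5⟩ := h
      rw [h1, normδ_rewind (wordCell_ne_lend h3)] at h4
      simp only [Option.some.injEq, Prod.mk.injEq] at h4
      obtain ⟨rfl, rfl, rfl⟩ := h4
      simp only [Move.Moves] at h5
      exact ⟨rfl, by omega⟩
  · rintro ⟨rfl, h⟩
    induction i with
    | zero =>
      obtain rfl : j = 0 := by omega
      exact .refl
    | succ i ih =>
      by_cases hj : j = i + 1
      · rw [hj]
      · obtain ⟨a, ha⟩ := exists_wordCell (u := u) (i := i + 1) (by omega) hi
        exact .head (b := (.rewind, i)) ⟨[], a, .left, ha, normδ_rewind (wordCell_ne_lend ha), rfl⟩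
          (ih (by omega) (by omega))

theorem reach_normalize_emit {u : List A} {p : Q} {i : ℕ} (h1 : 1 ≤ i) (h2 : i ≤ u.length)
    {s : NormState Q} {j : ℕ} (hj : j ≠ i) :
    Relation.ReflTransGen (T.normalize.WordStep u) (.emit p, i) (s, j) ↔
      ∃ v q m r, T.δ p .lend = some (v, q, m) ∧ s = .sim r ∧
        Relation.ReflTransGen (T.WordStep u) (q, match m with | .right => i | _ => i - 1) (r, j) := by
  obtain ⟨a, ha⟩ := exists_wordCell h1 h2
  have hne := wordCell_ne_lend ha
  constructor
  · intro h
    rcases Relation.ReflTransGen.cases_head h with h | ⟨⟨s', k⟩, ⟨v, a', m, h3, h4, h5⟩, h⟩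
    · cases h
      exact absurd rfl hj
    · rw [ha] at h3
      cases h3
      cases hp : T.δ p .lend with
      | none =>
        rw [normδ_emit_none hp] at h4
        cases h4
      | some t =>
        obtain ⟨v', q, m'⟩ := t
        rw [normδ_emit hne hp] at h4
        simp only [Option.some.injEq, Prod.mk.injEq] at h4
        obtain ⟨rfl, rfl, rfl⟩ := h4
        obtain ⟨r, rfl, hr⟩ := reach_normalize_sim.1 h
        refine ⟨v', q, m', r, rfl, rfl, ?_⟩
        cases m' with
        | right =>
          obtain rfl : k = i := h5
          exact hr
        | left =>
          obtain rfl : i = k + 1 := h5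
          exact hr
        | stay =>
          obtain rfl : i = k + 1 := h5
          exact hr
  · rintro ⟨v, q, m, r, hp, rfl, h⟩
    refine .head ⟨v, a, _, ha, normδ_emit hne hp, ?_⟩ (reach_normalize_sim.2 ⟨r, rfl, h⟩)
    cases m <;> simp [Move.Moves] <;> omega

/-- Runs that start on the last but one cell of a word. -/
theorem reach_before_last {y y' : List A} (hy : y ≠ []) (hy' : y' ≠ [])
    (hb : ∀ a b, T.beh a b y = T.beh a b y') {z : List A} (hz : 2 ≤ z.length) {x : Side} {q r : Q}
    (h : Relation.ReflTransGen (T.WordStep (y ++ z)) (q, (y ++ z).length - 1)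
      (r, x.exit (y ++ z).length)) :
    Relation.ReflTransGen (T.WordStep (y' ++ z)) (q, (y' ++ z).length - 1)
      (r, x.exit (y' ++ z).length) := by
  have hle := behLE_of_beh_eq hy hy' hb
  have h1 := reach_of_wordStep h
  have e : ∀ w : List A, (w ++ z).map EndMarked.letter =
      ([] : List (EndMarked A)) ++ (w.map .letter ++ z.map .letter) := by simp
  have hpos : ∀ w : List A, (w ++ z).length - 1 ≤ (w ++ z).length := fun w => by omega
  rw [e, if_pos (hpos y)] at h1
  -- As `z` has at least two letters, the last but one cell lies in `z`, outside of the replaced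
  -- factor.
  have hs : Outside 0 (y.map EndMarked.letter).length (y'.map EndMarked.letter).length
      (.rd q ((y ++ z).length - 1)) (.rd q ((y' ++ z).length - 1)) := by
    have := Outside.rd (k := 0) (m := (y.map EndMarked.letter).length)
      (m' := (y'.map EndMarked.letter).length) q (z.length - 1) (by omega)
    simp only [List.length_map, List.length_append] at this ⊢
    convert this using 2 <;> omega
  have h2 : Reach (T.cstep ((y' ++ z).map .letter)) (.rd q ((y' ++ z).length - 1))
      (x.confOut (y' ++ z).length r) := by
    rw [e]
    refine reach_replace_outside hle hs ?_ h1
    cases x with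
    | left =>
      rw [if_pos (by simp [Side.exit])]
      exact .left _ le_rfl
    | right =>
      rw [if_neg (by simp [Side.exit])]
      have := Outside.ex (k := 0) (m := (y.map EndMarked.letter).length)
        (m' := (y'.map EndMarked.letter).length) r z.length
      simp only [List.length_map, List.length_append, Side.confOut, zero_add] at this ⊢
      exact this
  have h3 := wordStep_of_reach h2
  cases x <;> exact h3

/-- The delicate states are those of the form `emit p`: after one step they continue as `T` does,
from the entry cell or from the cell to its left. When the word is entered from the right, the
latter is the last but one cell, of which the behaviors of `T` say nothing. The common suffix `z`
keeps it away from the factor that changes. -/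
theorem beh_normalize_subset {y y' z : List A} (hy : y ≠ []) (hy' : y' ≠ []) (hz : 2 ≤ z.length)
    (hb : ∀ a b, T.beh a b y = T.beh a b y')
    (hb' : ∀ a b, T.beh a b (y ++ z) = T.beh a b (y' ++ z)) (a b : Side) :
    T.normalize.beh a b (y ++ z) ⊆ T.normalize.beh a b (y' ++ z) := by
  have hpos : ∀ w : List A, w ≠ [] → 1 ≤ (w ++ z).length := by
    intro w _
    rw [List.length_append]
    omega
  have hentry : ∀ w : List A, w ≠ [] → 1 ≤ a.entry (w ++ z).length ∧
      a.entry (w ++ z).length ≤ (w ++ z).length := by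
    intro w hw
    have := hpos w hw
    cases a <;> simp only [Side.entry] <;> omega
  have hexit : ∀ w : List A, w ≠ [] → b.exit (w ++ z).length ≠ a.entry (w ++ z).length := by
    intro w hw
    have := hpos w hw
    cases a <;> cases b <;> simp only [Side.entry, Side.exit] <;> omega
  have hbeh : ∀ q r, Relation.ReflTransGen (T.WordStep (y ++ z)) (q, a.entry (y ++ z).length)
      (r, b.exit (y ++ z).length) → Relation.ReflTransGen (T.WordStep (y' ++ z))
        (q, a.entry (y' ++ z).length) (r, b.exit (y' ++ z).length) := by
    intro q r h
    have h' : (q, r) ∈ T.beh a b (y ++ z) := h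
    rw [hb'] at h'
    exact h'
  rintro ⟨p | p | _, s⟩ h
  · obtain ⟨q, hs, h'⟩ := reach_normalize_sim.1 h
    exact reach_normalize_sim.2 ⟨q, hs, hbeh _ _ h'⟩
  · obtain ⟨v, q, m, r, hp, hs, h⟩ :=
      (reach_normalize_emit (hentry y hy).1 (hentry y hy).2 (hexit y hy)).1 h
    refine (reach_normalize_emit (hentry y' hy').1 (hentry y' hy').2 (hexit y' hy')).2
      ⟨v, q, m, r, hp, hs, ?_⟩
    cases m with
    | right => exact hbeh _ _ h
    | left => exact absurd hp (T.lend_ne_left _ _ _)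
    | stay =>
      cases a with
      | right => exact reach_before_last hy hy' hb hz h
      -- Entered from the left, the word is left at once on the same side.
      | left =>
        simp only [Side.entry, Nat.sub_self] at h ⊢
        rcases Relation.ReflTransGen.cases_head h with h | ⟨c, ⟨w, x, m', h1, -⟩, -⟩
        · cases b with
          | left =>
            simp only [Side.exit] at h ⊢
            rw [h]
          | right => simp [Side.exit] at h
        · simp [wordCell] at h1
  · obtain ⟨h1, h2⟩ := (reach_normalize_rewind (hentry y hy).2).1 h
    refine (reach_normalize_rewind (hentry y' hy').2).2 ⟨h1, ?_⟩
    have h3 := hpos y hy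
    cases a <;> cases b <;> simp only [Side.entry, Side.exit] at h2 ⊢ <;> omega

theorem Aperiodic.normalize (hT : T.Aperiodic) : T.normalize.Aperiodic := by
  obtain ⟨n, hn⟩ := hT
  -- The summand `1` makes the replaced powers nonempty; the `2` provides the suffix `u ^ 2`, which
  -- has at least two letters.
  refine ⟨n + 1 + 2, fun x => ?_⟩
  induction x using Con.induction_on with
  | H u =>
  rw [← con_coe_pow, ← con_coe_pow, Con.eq]
  intro a b
  change T.normalize.beh a b (wordPow u.toList _) = T.normalize.beh a b (wordPow u.toList _)
  generalize u.toList = u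
  by_cases hu : u = []
  · subst hu
    have : ∀ k, wordPow ([] : List A) k = [] := fun k => by simp [wordPow]
    rw [this, this]
  have hz : 2 ≤ (wordPow u 2).length := by
    have := List.length_pos_of_ne_nil hu
    rw [show 2 = 1 + 1 from rfl, wordPow_add, wordPow_one, List.length_append]
    omega
  have h1 := wordPow_ne_nil hu n
  have h2 := wordPow_ne_nil hu (n + 1)
  have hb := beh_wordPow hn u 1
  have hb' := beh_wordPow hn u (1 + 2)
  have e1 : wordPow u (n + (1 + 2)) = wordPow u (n + 1) ++ wordPow u 2 := by
    rw [← wordPow_add]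
  have e2 : wordPow u (n + (1 + 2) + 1) = wordPow u (n + 1 + 1) ++ wordPow u 2 := by
    rw [← wordPow_add]
  rw [e1, e2] at hb'
  rw [show n + 1 + 2 + 1 = n + 1 + 1 + 2 by omega, wordPow_add u (n + 1), wordPow_add u (n + 1 + 1)]
  exact (beh_normalize_subset h1 h2 hz hb hb' a b).antisymm
    (beh_normalize_subset h2 h1 hz (fun a b => (hb a b).symm) (fun a b => (hb' a b).symm) a b)

end Transducer
end TwoWay

theorem mainTheorem8 {A B Q : Type*} [Finite A] [Finite B]
    (T : TwoWay.Transducer A B Q) (hT : T.Aperiodic) :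
    ((∃ lab, T.normalize.IsLabeling lab) ∧
      ∀ lab, T.normalize.IsLabeling lab →
        (T.normalize.toSST lab).Copyless ∧
        (∀ u v, (T.normalize.toSST lab).Realizes u v ↔ T.Realizes u v) ∧
        (T.normalize.toSST lab).Aperiodic) ∧
    (T.SilentAtLeft →
      (∃ lab, T.IsLabeling lab) ∧
      ∀ lab, T.IsLabeling lab →
        (T.toSST lab).Copyless ∧
        (∀ u v, (T.toSST lab).Realizes u v ↔ T.RealizesFromRight u v) ∧
        (T.toSST lab).Aperiodic) := by
  refine ⟨⟨T.normalize.exists_isLabeling, fun lab hlab => ⟨?_, fun u v => ?_, ?_⟩⟩,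
    fun hs => ⟨T.exists_isLabeling, fun lab hlab => ⟨?_, fun u v => ?_, ?_⟩⟩⟩
  · exact TwoWay.Transducer.copyless_toSST hlab
  · exact (TwoWay.Transducer.realizes_toSST TwoWay.Transducer.silentAtLeft_normalize hlab u v).trans
      (TwoWay.Transducer.realizesFromRight_normalize u v)
  · exact hT.normalize.toSST hlab
  · exact TwoWay.Transducer.copyless_toSST hlab
  · exact TwoWay.Transducer.realizes_toSST hs hlab u v
  · exact hT.toSST hlab
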